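/- **Setting.** Consider a two-player zero-sum Markov game with simultaneous moves: a measurable state space $\mathcal S$, a finite action set $\mathcal A$ for both players, horizon $H$, deterministic measurable rewards $r_h:\mathcal S\times\mathcal A\times\mathcal A\to[-1,1]$, transition kernels $\mathbb P_h(\cdot\mid x,a,b)$, and a fixed initial state $x_1$. Policies are sequences $\pi=(\pi_h)_{h\le H}$ of measurable maps $\pi_h:\mathcal S\to\Delta(\mathcal A)$; player 1 maximizes and player 2 minimizes $V^{\pi,\nu}_1(x_1)=\mathbb E_{\pi,\nu}[\sum_{h=1}^H r_h(x_h,a_h,b_h)]$, and $Q^{\pi,\nu}_h(x,a,b)=\mathbb E_{\pi,\nu}[\sum_{t\ge h}r_t(x_t,a_t,b_t)\mid x_h=x,a_h=a,b_h=b]$. For $f:\mathcal S\times\mathcal A\times\mathcal A\to\mathbb R$ write $f(x,\pi,\nu)=\mathbb E_{a\sim\pi(x),b\sim\nu(x)}f(x,a,b)$ and $f(x,\pi,b)=\mathbb E_{a\sim\pi(x)}f(x,a,b)$. We are given a policy class $\Pi=\Pi_1\times\dots\times\Pi_H$, used for both players, and a function class $\mathcal F=\mathcal F_1\times\dots\times\mathcal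 F_H$ of measurable functions $\mathcal F_h\subset\{\mathcal S\times\mathcal A\times\mathcal A\to[-1,1]\}$; put $f_{H+1}=0$. For all $h$, $\pi_h\in\Pi_h$, $f_h\in\mathcal F_h$ there is a best response $(\nu_\pi^f)_h\in\Pi_h$ minimizing $\nu\mapsto f_h(x,\pi_h,\nu)$ over $\Pi_h$ at every state $x$; fix any choice of these. Let $\nu_\pi^*\in\operatorname{argmin}_{\nu\in\Pi}V_1^{\pi,\nu}(x_1)$, $V^*=\sup_{\pi\in\Pi}\min_{\nu\in\Pi}V_1^{\pi,\nu}(x_1)$, and $$(\mathcal T_h^\pi f_{h+1})(x,a,b)=r_h(x,a,b)+\mathbb E_{x'\sim\mathbb P_h(\cdot\mid x,a,b)}\Big[\min_{\nu\in\Pi_{h+1}}f_{h+1}(x',\pi_{h+1},\nu)\Big].$$ **Assumptions.** *Strong realizability*: for every $\pi\in\Pi$ there is a best response $\nu_\pi^*\in\Pi$ with $Q_h^{\pi,\nu_\pi^*}\in\mathcal F_h$ for all $h$. *Strong completeness*: $\mathcal T_h^\pi f_{h+1}\in\mathcal F_h$ for all $\pi\in\Pi$, $f\in\mathcal F$, $h\in[H]$.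 **Complexities.** $\mathcal N(\mathcal F,\epsilon)$ is the covering number of $\mathcal F$ under $\max_h\|f_h-g_h\|_\infty$, and $\mathcal N(\Pi,\epsilon)$ that of $\Pi$ under $\max_h\sup_{f\in\mathcal F_h,x,b}|f(x,\pi_h,b)-f(x,\pi'_h,b)|$. For a function class $\Phi$ and a family $\mathcal D$ of distributions, $\dim_{\mathrm{DE}}(\Phi,\mathcal D,\epsilon)$ is the largest $n$ for which there are $\rho_1,\dots,\rho_n\in\mathcal D$ and $\epsilon'\ge\epsilon$ such that for each $i$ some $\phi\in\Phi$ has $\big(\sum_{j<i}(\mathbb E_{\rho_j}\phi)^2\big)^{1/2}\le\epsilon'<|\mathbb E_{\rho_i}\phi|$. Let $\mathcal D_{\Delta}$ be the Dirac measures on $\mathcal S\times\mathcal A\times\mathcal A$, let $\mathcal D_{\mathcal F,h}$ be the laws of $(x_h,a_h,b_h)$ obtained by executing $(\pi,\nu_\pi^g)$ from $x_1$, with $\pi\in\Pi$, $g\in\mathcal F$, and let $$d_{\mathrm{ME}'}=\max_{h\in[H]}\ \min_{\mathcal D\in\{\mathcal D_\Delta,\mathcal D_{\mathcal F,h}\}}\dim_{\mathrm{DE}}\big(\{f_h-\mathcal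 T_h^\pi f_{h+1}:f\in\mathcal F,\pi\in\Pi\},\mathcal D,\sqrt{1/K}\big).$$ **Algorithm (alternate optimistic value elimination).** Let $L=\log[\mathcal N(\mathcal F,1/K)\,\mathcal N(\Pi,1/K)\,HK/p]$ and $\beta=cL$. In episode $k=1,\dots,K$ let $\mathcal V^{k-1}$ be the set of $(\pi,f)\in\Pi\times\mathcal F$ such that for all $h$, $\ell_h(f_h,f,\pi)\le\inf_{g\in\mathcal F_h}\ell_h(g,f,\pi)+\beta$, where $$\ell_h(\xi,f,\pi)=\sum_{i<k}\big(\xi(x_h^i,a_h^i,b_h^i)-r_h(x_h^i,a_h^i,b_h^i)-f_{h+1}(x_{h+1}^i,\pi,\nu_\pi^f)\big)^2 .$$ Choose $(\pi^k,f^k)\in\mathcal V^{k-1}$ maximizing $f_1(x_1,\pi,\nu_\pi^f)$, then $g^k$ minimizing $g_1(x_1,\pi^k,\nu_{\pi^k}^g)$ over the $g$ with $(\pi^k,g)\in\mathcal V^{k-1}$, put $\nu^k=\nu_{\pi^k}^{g^k}$, and execute $(\pi^k,\nu^k)$ for one episode from $x_1$, observing $(x_h^k,a_h^k,b_h^k)_{h\le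 H}$. (The maximizers and minimizers are assumed to exist and to be chosen as measurable functions of the past episodes.) **Theorem.** There is an absolute constant $c_0>0$ such that for every $c\ge c_0$ there is a constant $C$ depending only on $c$ with the following property. Suppose $HK\ge2$, $0<p<1$, strong realizability and strong completeness hold, and $\mathcal N(\mathcal F,1/K)$, $\mathcal N(\Pi,1/K)$ and $d_{\mathrm{ME}'}$ are finite. Then with probability at least $1-p$ the algorithm satisfies $$\mathrm{Reg}(K)=\sum_{k=1}^K\big[V^*-V_1^{\pi^k,\nu_{\pi^k}^*}(x_1)\big]\le C\,H\sqrt{K\,\max\{1,d_{\mathrm{ME}'}\}\,\log\big[\mathcal N(\mathcal F,1/K)\,\mathcal N(\Pi,1/K)\,HK/p\big]} .$$ -/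

import Mathlib

open MeasureTheory ProbabilityTheory
open scoped NNReal ENNReal

noncomputable section

namespace MarkovGame

/-- A two-player zero-sum simultaneous-move episodic Markov game with common action set `A`,
`H` steps (numbered `0, …, H - 1`), rewards in `[-1, 1]`, transition kernels `trans h`
and a fixed initial state. -/
structure Game (S A : Type*) [MeasurableSpace S] [MeasurableSpace A] (H : ℕ) where
  reward : Fin H → S × A × A → ℝ
  reward_meas : ∀ h, Measurable (reward h)
  reward_bdd : ∀ h z, |reward h z| ≤ 1
  trans : Fin H → Kernel (S × A × A) S
  trans_markov : ∀ h, IsMarkovKernel (trans h)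
  init : S

/-- A stochastic one-step policy: a measurable map from states to distributions over actions. -/
abbrev StepPolicy (S A : Type*) [MeasurableSpace S] [MeasurableSpace A] :=
  {κ : Kernel S A // IsMarkovKernel κ}

/-- A stochastic policy: one step policy for each step. -/
abbrev Policy (S A : Type*) [MeasurableSpace S] [MeasurableSpace A] (H : ℕ) :=
  Fin H → StepPolicy S A

/-- A sequence of action-value functions, one for each step. -/
abbrev QSeq (S A : Type*) (H : ℕ) := Fin H → S × A × A → ℝ

section Basic

variable {S A : Type*} [MeasurableSpace S] [MeasurableSpace A] {H : ℕ}

/-- `f(x, π, ν) = E_{a ∼ π(x), b ∼ ν(x)} f(x, a, b)`. -/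
def evalQ (f : S × A × A → ℝ) (π ν : StepPolicy S A) (x : S) : ℝ :=
  ∫ a, ∫ b, f (x, a, b) ∂(ν.1 x) ∂(π.1 x)

/-- `f(x, π, b) = E_{a ∼ π(x)} f(x, a, b)`. -/
def evalQLeft (f : S × A × A → ℝ) (π : StepPolicy S A) (x : S) (b : A) : ℝ :=
  ∫ a, f (x, a, b) ∂(π.1 x)

/-- The law of `(x, a, b)` when `x ∼ m`, `a ∼ π(x)`, `b ∼ ν(x)`, with `a`, `b` independent
given `x`. -/
def stateActionLaw (m : Measure S) (π ν : StepPolicy S A) : Measure (S × A × A) :=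
  m ⊗ₘ (π.1 ×ₖ ν.1)

/-- The law of the state `n` steps later, when the state at step `h₀` has law `m` and the
policies `π`, `ν` are executed. -/
def stateLaw (G : Game S A H) (π ν : Policy S A H) (m : Measure S) (h₀ : ℕ) : ℕ → Measure S
  | 0 => m
  | n + 1 =>
    if hn : h₀ + n < H then
      (stateActionLaw (stateLaw G π ν m h₀ n) (π ⟨h₀ + n, hn⟩) (ν ⟨h₀ + n, hn⟩)).bind
        (G.trans ⟨h₀ + n, hn⟩)
    else 0

/-- The law of `(x_h, a_h, b_h)` when the state at step `h₀ ≤ h` has law `m` and the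
policies `π`, `ν` are executed. -/
def occupancy (G : Game S A H) (π ν : Policy S A H) (m : Measure S) (h₀ : ℕ) (h : Fin H) :
    Measure (S × A × A) :=
  stateActionLaw (stateLaw G π ν m h₀ (h - h₀)) (π h) (ν h)

/-- The expected reward `E [∑_{h ≥ h₀} r_h(x_h, a_h, b_h)]` when `x_{h₀} ∼ m`. -/
def expectedReward (G : Game S A H) (π ν : Policy S A H) (m : Measure S) (h₀ : ℕ) : ℝ :=
  ∑ h ∈ Finset.univ.filter (fun h : Fin H => h₀ ≤ (h : ℕ)), ∫ z, G.reward h z ∂(occupancy G π ν m h₀ h)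

/-- The value function `V^{π,ν}_h(x)`. -/
def value (G : Game S A H) (π ν : Policy S A H) (h : ℕ) (x : S) : ℝ :=
  expectedReward G π ν (Measure.dirac x) h

/-- The action-value function `Q^{π,ν}_h(x, a, b)`. -/
def qValue (G : Game S A H) (π ν : Policy S A H) : QSeq S A H := fun h z =>
  G.reward h z + expectedReward G π ν (G.trans h z) (h + 1)

/-- The product class `C_1 × ⋯ × C_H`. -/
def prodClass {α : Type*} (C : Fin H → Set α) : Set (Fin H → α) :=
  {c | ∀ h, c h ∈ C h}

/-- Every function of the class is measurable with values in `[-1, 1]`. -/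
def IsBoundedClass (F : Fin H → Set (S × A × A → ℝ)) : Prop :=
  ∀ h, ∀ f ∈ F h, Measurable f ∧ ∀ z, |f z| ≤ 1

/-- `br h f π` is a best response `ν_π^f ∈ argmin_{ν ∈ Π_h} f(x, π, ν)` (at all states `x`),
for `f ∈ F_h` and `π ∈ Π_h`. -/
def IsBestResponseMap (F : Fin H → Set (S × A × A → ℝ)) (P : Fin H → Set (StepPolicy S A))
    (br : Fin H → (S × A × A → ℝ) → StepPolicy S A → StepPolicy S A) : Prop :=
  ∀ h, ∀ f ∈ F h, ∀ π ∈ P h, br h f π ∈ P h ∧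
    ∀ ν ∈ P h, ∀ x, evalQ f π (br h f π) x ≤ evalQ f π ν x

/-- The policy `ν_π^f`. -/
def bestResponse (br : Fin H → (S × A × A → ℝ) → StepPolicy S A → StepPolicy S A)
    (f : QSeq S A H) (π : Policy S A H) : Policy S A H :=
  fun h => br h (f h) (π h)

/-- `f_n(x, π, ν)`, with the convention that it is zero after the last step. -/
def stageValue (f : QSeq S A H) (π ν : Policy S A H) (n : ℕ) (x : S) : ℝ :=
  if hn : n < H then evalQ (f ⟨n, hn⟩) (π ⟨n, hn⟩) (ν ⟨n, hn⟩) x else 0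

/-- `min_{ν ∈ Π_n} f_n(x, π, ν)`, with the convention that it is zero after the last step. -/
def minValue (P : Fin H → Set (StepPolicy S A)) (f : QSeq S A H) (π : Policy S A H)
    (n : ℕ) (x : S) : ℝ :=
  if hn : n < H then ⨅ ν : P ⟨n, hn⟩, evalQ (f ⟨n, hn⟩) (π ⟨n, hn⟩) ν.1 x else 0

/-- The Bellman operator for a fixed policy of the first player:
`(T^π_h f_{h+1})(x,a,b) = r_h(x,a,b) + E_{x' ∼ P_h(x,a,b)} min_{ν ∈ Π_{h+1}} f_{h+1}(x',π,ν)`. -/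
def bellman (G : Game S A H) (P : Fin H → Set (StepPolicy S A)) (π : Policy S A H)
    (f : QSeq S A H) (h : Fin H) (z : S × A × A) : ℝ :=
  G.reward h z + ∫ x', minValue P f π (h + 1) x' ∂(G.trans h z)

/-- Strong realizability: for every `π ∈ Π`, the action-value functions of `π` against its best
response `ν_π^* ∈ argmin_{ν ∈ Π} V^{π,ν}(x_1)` belong to the function class. -/
def StrongRealizability (G : Game S A H) (F : Fin H → Set (S × A × A → ℝ))
    (P : Fin H → Set (StepPolicy S A)) : Prop :=
  ∀ π ∈ prodClass P, ∃ ν ∈ prodClass P,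
    (∀ ν' ∈ prodClass P, value G π ν 0 G.init ≤ value G π ν' 0 G.init) ∧
    qValue G π ν ∈ prodClass F

/-- Strong completeness: `T^π_h f_{h+1} ∈ F_h` for all `π ∈ Π`, `f ∈ F` and all steps `h`. -/
def StrongCompleteness (G : Game S A H) (F : Fin H → Set (S × A × A → ℝ))
    (P : Fin H → Set (StepPolicy S A)) : Prop :=
  ∀ π ∈ prodClass P, ∀ f ∈ prodClass F, ∀ h, bellman G P π f h ∈ F h

/-- The covering number of `F` under `d(f, g) = max_h ‖f_h - g_h‖_∞`. -/
def coverF (F : Fin H → Set (S × A × A → ℝ)) (ε : ℝ≥0) : ℕ∞ :=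
  Metric.coveringNumber ε
    ((fun (f : QSeq S A H) (h : Fin H) => UniformFun.ofFun (f h)) '' prodClass F)

/-- The covering number of `Π` under
`d(π, π') = max_h max_{f ∈ F_h, x, b} |f(x, π_h, b) - f(x, π'_h, b)|`. -/
def coverP (F : Fin H → Set (S × A × A → ℝ)) (P : Fin H → Set (StepPolicy S A)) (ε : ℝ≥0) : ℕ∞ :=
  Metric.coveringNumber ε
    ((fun (π : Policy S A H) (h : Fin H) =>
      UniformFun.ofFun (fun q : F h × S × A => evalQLeft q.1.1 (π h) q.2.1 q.2.2)) '' prodClass P)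

/-- The distributional Eluder dimension: the largest length of a sequence of elements of `D` such
that, for some `ε' ≥ ε`, each element is `ε'`-independent of its predecessors w.r.t. `Φ`. -/
def dimDE {Z : Type*} [MeasurableSpace Z] (Φ : Set (Z → ℝ)) (D : Set (Measure Z)) (ε : ℝ) : ℕ∞ :=
  ⨆ (n : ℕ) (_ : ∃ ρ : Fin n → Measure Z, (∀ i, ρ i ∈ D) ∧ ∃ ε' : ℝ, ε ≤ ε' ∧
    ∀ i, ∃ g ∈ Φ, √(∑ j with j < i, (∫ z, g z ∂(ρ j)) ^ 2) ≤ ε' ∧ ε' < |∫ z, g z ∂(ρ i)|),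
    (n : ℕ∞)

/-- The Bellman residuals `f_h - T^π_h f_{h+1}` with `f ∈ F`, `π ∈ Π`. -/
def residuals (G : Game S A H) (F : Fin H → Set (S × A × A → ℝ))
    (P : Fin H → Set (StepPolicy S A)) (h : Fin H) : Set (S × A × A → ℝ) :=
  {g | ∃ f ∈ prodClass F, ∃ π ∈ prodClass P, g = fun z => f h z - bellman G P π f h z}

/-- The Dirac measures on state-action triples. -/
def diracFamily (S A : Type*) [MeasurableSpace S] [MeasurableSpace A] :
    Set (Measure (S × A × A)) :=
  Set.range Measure.dirac

/-- The laws of `(x_h, a_h, b_h)` generated by executing `(π, ν_π^g)` from the initial state,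
`π ∈ Π`, `g ∈ F`. -/
def executedFamily (G : Game S A H) (F : Fin H → Set (S × A × A → ℝ))
    (P : Fin H → Set (StepPolicy S A))
    (br : Fin H → (S × A × A → ℝ) → StepPolicy S A → StepPolicy S A) (h : Fin H) :
    Set (Measure (S × A × A)) :=
  {ρ | ∃ π ∈ prodClass P, ∃ g ∈ prodClass F,
    ρ = occupancy G π (bestResponse br g π) (Measure.dirac G.init) 0 h}

/-- The Minimax Eluder dimension in the coordinated setting. -/
def dimME (G : Game S A H) (F : Fin H → Set (S × A × A → ℝ)) (P : Fin H → Set (StepPolicy S A))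
    (br : Fin H → (S × A × A → ℝ) → StepPolicy S A → StepPolicy S A) (ε : ℝ) : ℕ∞ :=
  ⨆ h : Fin H, min (dimDE (residuals G F P h) (diracFamily S A) ε)
    (dimDE (residuals G F P h) (executedFamily G F P br h) ε)

/-- The squared loss at step `h` over the episodes before episode `k` of the function `ξ`, with
regression targets `r_h + f_{h+1}(x_{h+1}, π, ν_π^f)`; `Z i h = (x_h^i, a_h^i, b_h^i)`. -/
def sqLoss (G : Game S A H) (br : Fin H → (S × A × A → ℝ) → StepPolicy S A → StepPolicy S A)
    {K : ℕ} (Z : Fin K → Fin H → S × A × A) (k : Fin K) (h : Fin H) (ξ : S × A × A → ℝ)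
    (π : Policy S A H) (f : QSeq S A H) : ℝ :=
  ∑ i : Fin K with i < k, (ξ (Z i h) - G.reward h (Z i h) -
    (if hn : (h : ℕ) + 1 < H then
      stageValue f π (bestResponse br f π) (h + 1) (Z i ⟨h + 1, hn⟩).1 else 0)) ^ 2

/-- The constraint set available at the start of episode `k`. -/
def constraintSet (G : Game S A H) (F : Fin H → Set (S × A × A → ℝ))
    (P : Fin H → Set (StepPolicy S A))
    (br : Fin H → (S × A × A → ℝ) → StepPolicy S A → StepPolicy S A) (β : ℝ)
    {K : ℕ} (Z : Fin K → Fin H → S × A × A) (k : Fin K) : Set (Policy S A H × QSeq S A H) :=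
  {q | q.1 ∈ prodClass P ∧ q.2 ∈ prodClass F ∧
    ∀ h, sqLoss G br Z k h (q.2 h) q.1 q.2 ≤ (⨅ g : F h, sqLoss G br Z k h g.1 q.1 q.2) + β}

/-- The optimistic or pessimistic estimate `f_1(x_1, π, ν_π^f)` of the game value. -/
def initValue (G : Game S A H)
    (br : Fin H → (S × A × A → ℝ) → StepPolicy S A → StepPolicy S A)
    (q : Policy S A H × QSeq S A H) : ℝ :=
  stageValue q.2 q.1 (bestResponse br q.2 q.1) 0 G.init

section History

variable {Ω : Type*} {K : ℕ}

/-- The σ-algebra generated by the episodes before episode `k`. -/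
abbrev pastEpisodes (Z : Fin K → Fin H → Ω → S × A × A) (k : Fin K) : MeasurableSpace Ω :=
  ⨆ (i : Fin K) (_ : i < k) (h : Fin H), MeasurableSpace.comap (Z i h) inferInstance

/-- The σ-algebra generated by the history up to and including the state `x_h^k`. -/
abbrev beforeActions (Z : Fin K → Fin H → Ω → S × A × A) (k : Fin K) (h : Fin H) :
    MeasurableSpace Ω :=
  pastEpisodes Z k ⊔ (⨆ (j : Fin H) (_ : j < h), MeasurableSpace.comap (Z k j) inferInstance) ⊔
    MeasurableSpace.comap (fun ω => (Z k h ω).1) inferInstance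

/-- The σ-algebra generated by the history up to and including `(x_h^k, a_h^k, b_h^k)`. -/
abbrev afterActions (Z : Fin K → Fin H → Ω → S × A × A) (k : Fin K) (h : Fin H) :
    MeasurableSpace Ω :=
  pastEpisodes Z k ⊔ ⨆ (j : Fin H) (_ : j ≤ h), MeasurableSpace.comap (Z k j) inferInstance

end History

/-- A run of `K` episodes of alternate optimistic value elimination with parameter `β`, on a
probability space `(Ω, μ)`. `Z k h = (x_h^k, a_h^k, b_h^k)` is the observed data,
`π k`, `f k`, `g k` are the choices of the algorithm in episode `k`, and the second player executes
`ν^k = ν_{π^k}^{g^k}`. -/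
structure IsRun (G : Game S A H) (F : Fin H → Set (S × A × A → ℝ))
    (P : Fin H → Set (StepPolicy S A))
    (br : Fin H → (S × A × A → ℝ) → StepPolicy S A → StepPolicy S A) (β : ℝ)
    {K : ℕ} {Ω : Type*} [MeasurableSpace Ω] (μ : Measure Ω)
    (Z : Fin K → Fin H → Ω → S × A × A) (π : Fin K → Ω → Policy S A H)
    (f g : Fin K → Ω → QSeq S A H) : Prop where
  meas : ∀ k h, Measurable (Z k h)
  /-- The choices in episode `k` depend (measurably) on the previous episodes only. -/
  meas_π : ∀ k h (a : A), Measurable[(pastEpisodes Z k).prod inferInstance]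
    (fun q : Ω × S => ((π k q.1 h).1 q.2).real {a})
  meas_ν : ∀ k h (b : A), Measurable[(pastEpisodes Z k).prod inferInstance]
    (fun q : Ω × S => ((bestResponse br (g k q.1) (π k q.1) h).1 q.2).real {b})
  meas_f : ∀ k h, Measurable[(pastEpisodes Z k).prod inferInstance]
    (fun q : Ω × (S × A × A) => f k q.1 h q.2)
  meas_g : ∀ k h, Measurable[(pastEpisodes Z k).prod inferInstance]
    (fun q : Ω × (S × A × A) => g k q.1 h q.2)
  /-- `(π^k, f^k)` maximizes `f_1(x_1, π, ν_π^f)` over the constraint set. -/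
  optimistic : ∀ k ω, IsMaxOn (initValue G br)
    (constraintSet G F P br β (fun i h => Z i h ω) k) (π k ω, f k ω)
  optimistic_mem : ∀ k ω, (π k ω, f k ω) ∈ constraintSet G F P br β (fun i h => Z i h ω) k
  /-- `g^k` minimizes `g_1(x_1, π^k, ν_{π^k}^g)` over the `g` with `(π^k, g)` in the constraint
  set. -/
  pessimistic : ∀ k ω, IsMinOn (fun g' => initValue G br (π k ω, g'))
    {g' | (π k ω, g') ∈ constraintSet G F P br β (fun i h => Z i h ω) k} (g k ω)
  pessimistic_mem : ∀ k ω, (π k ω, g k ω) ∈ constraintSet G F P br β (fun i h => Z i h ω) k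
  /-- Every episode starts in `x_1`. -/
  start : ∀ k ω (h : Fin H), (h : ℕ) = 0 → (Z k h ω).1 = G.init
  /-- Given the history and `x_h^k`, the actions are independent with laws `π_h^k(x_h^k)` and
  `ν_h^k(x_h^k)`. -/
  actions : ∀ k h (a b : A),
    μ[({ω | (Z k h ω).2 = (a, b)} : Set Ω).indicator (fun _ => (1 : ℝ)) | beforeActions Z k h]
      =ᵐ[μ] fun ω => ((π k ω h).1 (Z k h ω).1).real {a} *
        ((bestResponse br (g k ω) (π k ω) h).1 (Z k h ω).1).real {b}
  /-- Given the history and `(x_h^k, a_h^k, b_h^k)`, the next state has law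
  `P_h(x_h^k, a_h^k, b_h^k)`. -/
  transition : ∀ (k : Fin K) (h : Fin H) (hn : (h : ℕ) + 1 < H) (s : Set S), MeasurableSet s →
    μ[({ω | (Z k ⟨h + 1, hn⟩ ω).1 ∈ s} : Set Ω).indicator (fun _ => (1 : ℝ)) | afterActions Z k h]
      =ᵐ[μ] fun ω => (G.trans h (Z k h ω)).real s

/-- The value of the first player's policy `π` against its best response in `Π`. -/
def worstValue (G : Game S A H) (P : Fin H → Set (StepPolicy S A)) (π : Policy S A H) : ℝ :=
  ⨅ ν : prodClass P, value G π ν.1 0 G.init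

/-- The optimal value `V^* = max_{π ∈ Π} min_{ν ∈ Π} V^{π,ν}(x_1)`. -/
def gameValue (G : Game S A H) (P : Fin H → Set (StepPolicy S A)) : ℝ :=
  ⨆ π : prodClass P, worstValue G P π.1

/-- The one-sided duality-gap regret `∑_k (V^* - V^{π^k, ν_{π^k}^*}(x_1))`. -/
def regret (G : Game S A H) (P : Fin H → Set (StepPolicy S A)) {K : ℕ}
    (π : Fin K → Policy S A H) : ℝ :=
  ∑ k, (gameValue G P - worstValue G P (π k))

/-- `log [N(F, 1/K) · N(Π, 1/K) · H K / p]`. -/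
def logTerm (F : Fin H → Set (S × A × A → ℝ)) (P : Fin H → Set (StepPolicy S A))
    (K : ℕ) (p : ℝ) : ℝ :=
  Real.log ((coverF F (1 / K)).toNat * (coverP F P (1 / K)).toNat * H * K / p)

end Basic

end MarkovGame

end

namespace MarkovGame

/-! ### Covering numbers and finite nets -/

section Cover

/-! Optimism. For a fixed policy π of the first player, completeness lets the backward recursion Q_h
= T_h^π Q_{h+1} be solved inside F. Since Π is a product and best responses are optimal at all
states at once, the initial value of Q is the worst-case value of π (`worstValue_eq_initValue`). If
all these pairs (π, Q) lie in the constraint set, the estimate from f^k is at least V^*, and the one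
from g^k is at most the worst-case value of π^k. The loss of episode k is therefore at most the
difference of the two estimates. Replacing the best response to f^k by ν^k only raises the first
estimate, and telescoping along (π^k, ν^k) turns the difference into a sum over steps of expected
differences of on-policy residuals (`sum_integral_policyResidual`). As ν^k is the best response to
g^k, these are bounded by differences of Bellman residuals (`IsRun.residualGap_le`).

Regression. The loss of u minus that of T f is a sum of terms R² + 2 R · noise, where R = u - T f
and the noise is conditionally centred. An exponential supermartingale with tilt proportional to R
makes the noise cost only a fraction of ∑ R² plus a logarithm. A union bound over a 1/K-net of Π × F
then gives, for all pairs, excess loss ≥ ½ ∑ R² - 100 L (`half_sum_sq_le_excess`). Read one way this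
puts the pairs (π, Q) in every constraint set; read the other way it bounds ∑ R² by O(L) for every
member. A second supermartingale passes from observed squares to squares of conditional expectations
(`sum_sq_integral_le`).

Eluder argument. If each residual has squares summing to at most B along the earlier laws, only d +
B d / α² of them can exceed α in mean. Summing over levels gives O(√(K d B))
(`sum_abs_integral_le_of_dimDE_le`). With laws of executed policies this bounds the expected gaps
directly; with Dirac measures it bounds the observed ones, and one more martingale bound returns to
expectations. -/

lemma exists_finset_cover {ι X : Type*} [PseudoEMetricSpace X] (e : ι → X) (A : Set ι) (ε : ℝ≥0)
    (h : Metric.coveringNumber ε (e '' A) ≠ ⊤) :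
    ∃ s : Finset ι, ↑s ⊆ A ∧ s.card ≤ (Metric.coveringNumber ε (e '' A)).toNat ∧
      ∀ a ∈ A, ∃ b ∈ s, edist (e a) (e b) ≤ ε := by
  classical
  obtain ⟨C, hCA, hfin, hcov, hcard⟩ := Metric.exists_set_encard_eq_coveringNumber h
  choose u huA hu using fun y : hfin.toFinset => hCA (hfin.mem_toFinset.1 y.2)
  refine ⟨Finset.univ.image u, ?_, ?_, ?_⟩
  · intro x hx
    simp only [Finset.coe_image, Finset.coe_univ, Set.image_univ] at hx
    obtain ⟨y, rfl⟩ := hx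
    exact huA y
  · refine Finset.card_image_le.trans ?_
    rw [← hcard, hfin.encard_eq_coe_toFinset_card]
    simp
  · intro a ha
    obtain ⟨y, hy, hay⟩ := hcov (Set.mem_image_of_mem e ha)
    refine ⟨u ⟨y, hfin.mem_toFinset.2 hy⟩, Finset.mem_image_of_mem _ (Finset.mem_univ _), ?_⟩
    rw [hu]
    exact hay

lemma abs_sub_le_of_edist_uniformFun {α : Type*} {f g : α → ℝ} {ε : ℝ≥0}
    (h : edist (UniformFun.ofFun f) (UniformFun.ofFun g) ≤ ε) (x : α) : |f x - g x| ≤ ε := by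
  have := UniformFun.edist_le.1 h x
  simp only [UniformFun.toFun_ofFun] at this
  rw [edist_nndist] at this
  have h2 : nndist (f x) (g x) ≤ ε := by exact_mod_cast this
  rw [← Real.dist_eq]
  exact_mod_cast h2

end Cover

/-! ### Eluder dimension: counting and summing large residuals -/

section Eluder

/-- Greedy distribution of the elements of a finite ordered set into `M` classes, in each of which
every element has small total weight from its predecessors. -/
lemma exists_coloring {ι : Type*} [LinearOrder ι] (T : Finset ι) (w : ι → ι → ℝ)
    {β η : ℝ} {M : ℕ} (hM : 0 < M) (hβ : β ≤ M * η)
    (h : ∀ k ∈ T, ∑ j ∈ T with j < k, w j k ≤ β) :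
    ∃ c : ι → Fin M, ∀ k ∈ T, ∑ j ∈ T with j < k ∧ c j = c k, w j k ≤ η := by
  induction T using Finset.induction_on_max with
  | empty => exact ⟨fun _ => ⟨0, hM⟩, by simp⟩
  | insert a s ha ih =>
    have hfil : ∀ k ∈ s, ∀ (q : ι → Prop) [DecidablePred q],
        (insert a s).filter (fun j => j < k ∧ q j) = s.filter (fun j => j < k ∧ q j) := by
      intro k hk q _
      rw [Finset.filter_insert, if_neg]
      exact fun hh => (lt_asymm hh.1 (ha k hk))
    have hfa : ∀ (q : ι → Prop) [DecidablePred q],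
        (insert a s).filter (fun j => j < a ∧ q j) = s.filter q := by
      intro q _
      rw [Finset.filter_insert, if_neg (fun hh => lt_irrefl _ hh.1)]
      refine Finset.filter_congr fun j hj => ?_
      simp [ha j hj]
    obtain ⟨c, hc⟩ := ih (by
      intro k hk
      have := h k (Finset.mem_insert_of_mem hk)
      have h2 := hfil k hk (fun _ => True)
      simp only [and_true] at h2
      rwa [h2] at this)
    have hsum : ∑ j ∈ s, w j a ≤ β := by
      have := h a (Finset.mem_insert_self _ _)
      have h2 := hfa (fun _ => True)
      simp only [and_true, Finset.filter_true] at h2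
      rwa [h2] at this
    -- Pigeonhole: if the weight from every class exceeded `η`, the total would exceed `M * η ≥ β`.
    -- Adding the largest element leaves the sums of the earlier ones unchanged.
    have hex : ∃ m : Fin M, ∑ j ∈ s with c j = m, w j a ≤ η := by
      by_contra! hcon
      have h1 : ∑ m : Fin M, η < ∑ m : Fin M, ∑ j ∈ s with c j = m, w j a :=
        Finset.sum_lt_sum_of_nonempty ⟨⟨0, hM⟩, Finset.mem_univ _⟩ fun m _ => hcon m
      rw [Finset.sum_fiberwise] at h1
      simp at h1
      linarith
    obtain ⟨m, hm⟩ := hex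
    have has : a ∉ s := fun hh => lt_irrefl _ (ha a hh)
    refine ⟨Function.update c a m, ?_⟩
    have hne : ∀ j ∈ s, Function.update c a m j = c j := fun j hj =>
      Function.update_of_ne (by rintro rfl; exact has hj) _ _
    intro k hk
    rcases Finset.mem_insert.1 hk with rfl | hk
    · rw [hfa, Function.update_self]
      refine le_of_eq_of_le (Finset.sum_congr (Finset.filter_congr fun j hj => ?_)
        fun _ _ => rfl) hm
      rw [hne j hj]
    · rw [hfil k hk, hne k hk]
      refine le_of_eq_of_le (Finset.sum_congr (Finset.filter_congr fun j hj => ?_)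
        fun _ _ => rfl) (hc k hk)
      rw [hne j hj]

variable {Z : Type*} [MeasurableSpace Z]

/-- Listed in increasing order, `U` is itself a sequence of the kind counted by `dimDE`. -/
lemma card_le_of_dimDE_le {Φ : Set (Z → ℝ)} {D : Set (Measure Z)} {ε ε' : ℝ} {d : ℕ}
    (hd : dimDE Φ D ε ≤ d) (hε : ε ≤ ε') {ι : Type*} [LinearOrder ι] (U : Finset ι)
    (ρ : ι → Measure Z) (φ : ι → Z → ℝ) (hρ : ∀ i ∈ U, ρ i ∈ D) (hφ : ∀ i ∈ U, φ i ∈ Φ)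
    (hpos : 0 ≤ ε')
    (hsum : ∀ k ∈ U, ∑ j ∈ U with j < k, (∫ z, φ k z ∂(ρ j)) ^ 2 ≤ ε' ^ 2)
    (hlt : ∀ k ∈ U, ε' < |∫ z, φ k z ∂(ρ k)|) : U.card ≤ d := by
  have key : (U.card : ℕ∞) ≤ dimDE Φ D ε := by
    unfold dimDE
    refine le_iSup₂_of_le U.card ?_ le_rfl
    refine ⟨fun i => ρ (U.orderEmbOfFin rfl i), fun i => hρ _ (U.orderEmbOfFin_mem rfl i), ε', hε,
      fun i => ⟨φ (U.orderEmbOfFin rfl i), hφ _ (U.orderEmbOfFin_mem rfl i), ?_,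
        hlt _ (U.orderEmbOfFin_mem rfl i)⟩⟩
    rw [Real.sqrt_le_left hpos]
    refine le_trans ?_ (hsum _ (U.orderEmbOfFin_mem rfl i))
    refine le_of_eq_of_le (Finset.sum_map (Finset.univ.filter (· < i))
      (U.orderEmbOfFin rfl).toEmbedding
      (fun x => (∫ z, φ (U.orderEmbOfFin rfl i) z ∂(ρ x)) ^ 2)).symm ?_
    refine Finset.sum_le_sum_of_subset_of_nonneg ?_ fun _ _ _ => sq_nonneg _
    intro x hx
    simp only [Finset.mem_map, Finset.mem_filter, Finset.mem_univ, true_and] at hx ⊢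
    obtain ⟨j, hj, rfl⟩ := hx
    exact ⟨U.orderEmbOfFin_mem rfl j, (U.orderEmbOfFin rfl).strictMono hj⟩
  exact_mod_cast key.trans hd

/-- The large terms split into about `β / ε' ^ 2` classes, in each of which every term is
`ε'`-independent of its predecessors, so that each class has at most `d` members. -/
lemma card_filter_lt_le_of_dimDE_le {Φ : Set (Z → ℝ)} {D : Set (Measure Z)} {ε ε' β : ℝ} {d : ℕ}
    (hd : dimDE Φ D ε ≤ d) (hε : ε ≤ ε') (hpos : 0 < ε') (hβ : 0 ≤ β) {K : ℕ}
    (ρ : Fin K → Measure Z) (φ : Fin K → Z → ℝ) (hρ : ∀ i, ρ i ∈ D) (hφ : ∀ i, φ i ∈ Φ)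
    (hsum : ∀ k, ∑ j with j < k, (∫ z, φ k z ∂(ρ j)) ^ 2 ≤ β) :
    ((Finset.univ.filter fun k => ε' < |∫ z, φ k z ∂(ρ k)|).card : ℝ) ≤
      d + β * d / ε' ^ 2 := by
  set T := Finset.univ.filter fun k => ε' < |∫ z, φ k z ∂(ρ k)| with hT
  set M := ⌊β / ε' ^ 2⌋₊ + 1 with hM
  have hMge : β ≤ M * ε' ^ 2 := by
    have := (Nat.lt_floor_add_one (β / ε' ^ 2)).le
    rw [div_le_iff₀ (by positivity)] at this
    rw [hM]; push_cast; exact this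
  obtain ⟨c, hc⟩ := exists_coloring T (fun j k => (∫ z, φ k z ∂(ρ j)) ^ 2)
    (β := β) (η := ε' ^ 2) (M := M) (by omega) hMge (by
      intro k _
      refine le_trans (Finset.sum_le_sum_of_subset_of_nonneg ?_ fun _ _ _ => sq_nonneg _) (hsum k)
      exact Finset.filter_subset_filter _ (Finset.subset_univ _))
  have hcard : T.card ≤ M * d := by
    rw [Finset.card_eq_sum_card_fiberwise (f := c) (t := Finset.univ) (fun _ _ => by simp)]
    refine (Finset.sum_le_card_nsmul _ _ d fun m _ => ?_).trans (by simp)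
    refine card_le_of_dimDE_le hd hε _ ρ φ (fun i _ => hρ i) (fun i _ => hφ i) hpos.le ?_ ?_
    · intro k hk
      obtain ⟨hkT, hkm⟩ := Finset.mem_filter.1 hk
      refine le_of_eq_of_le (Finset.sum_congr ?_ fun _ _ => rfl) (hc k hkT)
      rw [Finset.filter_filter]
      refine Finset.filter_congr fun j _ => ?_
      rw [hkm, and_comm]
    · intro k hk
      exact (Finset.mem_filter.1 (Finset.mem_filter.1 hk).1).2
  have h1 : (T.card : ℝ) ≤ M * d := by exact_mod_cast hcard
  have h2 : (M : ℝ) ≤ β / ε' ^ 2 + 1 := by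
    rw [hM]; push_cast
    have := Nat.floor_le (show 0 ≤ β / ε' ^ 2 by positivity)
    linarith
  calc (T.card : ℝ) ≤ (β / ε' ^ 2 + 1) * d := h1.trans (by gcongr)
    _ = d + β * d / ε' ^ 2 := by ring

/-- A bound on the sum from a bound on the number of large terms. -/
lemma sum_le_of_card_filter_lt_le {ι : Type*} (w : ι → ℝ) {C ε B : ℝ} {d : ℕ} (hε : 0 ≤ ε)
    (hB : 0 ≤ B) (hwC : ∀ i, w i ≤ C) (n : ℕ) :
    ∀ T : Finset ι, T.card = n →
    (∀ α, ε ≤ α → 0 < α → ((T.filter fun k => α < w k).card : ℝ) ≤ d + B / α ^ 2) →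
    ∑ i ∈ T, w i ≤ ε * n + C * (min n d : ℕ) + 2 * √B * √(n - d : ℕ) := by
  classical
  induction n with
  | zero =>
    intro T hT _
    rw [Finset.card_eq_zero.1 hT]
    simp
  | succ n ih =>
    intro T hT hcount
    have hne : T.Nonempty := by rw [← Finset.card_pos]; omega
    obtain ⟨k, hkT, hkmin⟩ := T.exists_min_image w hne
    have hih := ih (T.erase k) (by rw [Finset.card_erase_of_mem hkT]; omega) (by
      intro α h1 h2
      refine le_trans ?_ (hcount α h1 h2)
      exact_mod_cast Finset.card_le_card (Finset.filter_subset_filter _ (Finset.erase_subset _ _)))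
    rw [← Finset.add_sum_erase _ _ hkT]
    by_cases hnd : n + 1 ≤ d
    · have h1 : min (n + 1) d = n + 1 := by omega
      have h2 : min n d = n := by omega
      have h3 : n - d = 0 := by omega
      have h4 : n + 1 - d = 0 := by omega
      rw [h2, h3] at hih
      rw [h1, h4]
      push_cast at hih ⊢
      have := hwC k
      linarith
    · obtain ⟨m, rfl⟩ : ∃ m, n = d + m := ⟨n - d, by omega⟩
      have h1 : min (d + m + 1) d = d := by omega
      have h2 : min (d + m) d = d := by omega
      have h3 : d + m - d = m := by omega
      have h4 : d + m + 1 - d = m + 1 := by omega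
      rw [h2, h3] at hih
      rw [h1, h4]
      have hs : 0 < √((m + 1 : ℕ) : ℝ) := Real.sqrt_pos.2 (by positivity)
      have hsq : √((m + 1 : ℕ) : ℝ) ^ 2 = m + 1 := by
        rw [Real.sq_sqrt (by positivity)]; push_cast; ring
      -- `w k` is the smallest of `d + m + 1` terms. At a level `α` just below it all of them count
      -- as large, so `m + 1 ≤ B / α ^ 2`.
      have hwk : w k ≤ ε + √B / √((m + 1 : ℕ) : ℝ) := by
        by_contra! hlt
        have hpos : 0 ≤ √B / √((m + 1 : ℕ) : ℝ) := by positivity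
        set α := (ε + √B / √((m + 1 : ℕ) : ℝ) + w k) / 2 with hα
        have hα1 : ε + √B / √((m + 1 : ℕ) : ℝ) < α := by rw [hα]; linarith
        have hα2 : α < w k := by rw [hα]; linarith
        have hαpos : 0 < α := by linarith
        have hc := hcount α (by linarith) hαpos
        rw [Finset.filter_true_of_mem fun i hi => hα2.trans_le (hkmin i hi), hT] at hc
        have h5 : √B < α * √((m + 1 : ℕ) : ℝ) := by
          rw [← div_lt_iff₀ hs]; linarith
        have h6 : B < α ^ 2 * (m + 1) := by
          rw [← hsq, ← mul_pow]
          calc B = √B ^ 2 := (Real.sq_sqrt hB).symm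
            _ < _ := by gcongr
        have h7 : B / α ^ 2 < m + 1 := by
          rw [div_lt_iff₀ (by positivity)]; linarith
        push_cast at hc
        linarith
      -- The discrete form of 1/√x ≤ d(2√x)/dx, which absorbs the new term into `2 * √B * √(m + 1)`.
      have hincr : √B / √((m + 1 : ℕ) : ℝ) ≤
          2 * √B * √((m + 1 : ℕ) : ℝ) - 2 * √B * √(m : ℝ) := by
        have hm : √(m : ℝ) ^ 2 = m := Real.sq_sqrt (by positivity)
        have h0 : 0 ≤ √(m : ℝ) := Real.sqrt_nonneg _
        have hB0 : 0 ≤ √B := Real.sqrt_nonneg _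
        rw [div_le_iff₀ hs]
        have : 1 ≤ 2 * (√((m + 1 : ℕ) : ℝ) - √(m : ℝ)) * √((m + 1 : ℕ) : ℝ) := by
          nlinarith [sq_nonneg (√((m + 1 : ℕ) : ℝ) - √(m : ℝ))]
        nlinarith
      push_cast at hih hwk hincr ⊢
      linarith

/-- Total of the values `|E_{ρ_k} φ_k|` when each `φ_k` has small squares along its
predecessors. -/
lemma sum_abs_integral_le_of_dimDE_le {Φ : Set (Z → ℝ)} {D : Set (Measure Z)} {K : ℕ}
    {β C : ℝ} {d : ℕ} (hd : dimDE Φ D √(1 / K) ≤ d) (hβ : 0 ≤ β) (hC : 0 ≤ C)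
    (ρ : Fin K → Measure Z) (φ : Fin K → Z → ℝ) (hρ : ∀ i, ρ i ∈ D) (hφ : ∀ i, φ i ∈ Φ)
    (hφC : ∀ k, |∫ z, φ k z ∂(ρ k)| ≤ C)
    (hsum : ∀ k, ∑ j with j < k, (∫ z, φ k z ∂(ρ j)) ^ 2 ≤ β) :
    ∑ k, |∫ z, φ k z ∂(ρ k)| ≤ √(K * max 1 (d : ℝ)) * (1 + C + 2 * √β) := by
  have h := sum_le_of_card_filter_lt_le (fun k => |∫ z, φ k z ∂(ρ k)|) (C := C)
    (ε := √(1 / K)) (B := β * d) (d := d) (Real.sqrt_nonneg _) (by positivity) hφC K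
    Finset.univ (by simp) (fun α h1 h2 =>
      card_filter_lt_le_of_dimDE_le hd h1 h2 hβ ρ φ hρ hφ hsum)
  refine h.trans ?_
  have hK : (0 : ℝ) ≤ K := by positivity
  have hm1 : (1 : ℝ) ≤ max 1 (d : ℝ) := le_max_left _ _
  have hm2 : (d : ℝ) ≤ max 1 (d : ℝ) := le_max_right _ _
  have e1 : √(1 / K) * K ≤ √(K * max 1 (d : ℝ)) := by
    have : √(1 / K) * (K : ℝ) = √K := by
      rw [one_div, Real.sqrt_inv]
      rcases eq_or_lt_of_le hK with h0 | h0
      · simp [← h0]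
      · field_simp
        rw [Real.sq_sqrt hK]
    rw [this]
    exact Real.sqrt_le_sqrt (by nlinarith)
  have e2 : ((min K d : ℕ) : ℝ) ≤ √(K * max 1 (d : ℝ)) := by
    refine Real.le_sqrt_of_sq_le ?_
    have a1 : ((min K d : ℕ) : ℝ) ≤ K := by exact_mod_cast min_le_left _ _
    have a2 : ((min K d : ℕ) : ℝ) ≤ d := by exact_mod_cast min_le_right _ _
    rw [sq]
    exact mul_le_mul a1 (a2.trans hm2) (by positivity) hK
  have e3 : √(β * d) * √(K - d : ℕ) ≤ √(K * max 1 (d : ℝ)) * √β := by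
    rw [← Real.sqrt_mul (by positivity), ← Real.sqrt_mul (by positivity)]
    refine Real.sqrt_le_sqrt ?_
    have a1 : ((K - d : ℕ) : ℝ) ≤ K := by exact_mod_cast Nat.sub_le _ _
    calc β * d * ((K - d : ℕ) : ℝ) ≤ β * max 1 (d : ℝ) * K := by gcongr
      _ = _ := by ring
  nlinarith [mul_le_mul_of_nonneg_left e2 hC]

end Eluder

/-! ### Conditional laws and exponential supermartingales -/

section Concentration

variable {Ω E : Type*} {m mΩ : MeasurableSpace Ω} {mE : MeasurableSpace E}

/-- `κ` is a conditional law of `X` given `m`, expressed through integrals of functions which are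
jointly measurable with respect to `m` and the value of `X`. -/
def IsCondLaw (m : MeasurableSpace Ω) {mΩ : MeasurableSpace Ω} (μ : Measure Ω) (X : Ω → E) (κ : Ω → Measure E) : Prop :=
  ∀ F : Ω × E → ℝ≥0∞, Measurable[m.prod mE] F →
    ∫⁻ ω, F (ω, X ω) ∂μ = ∫⁻ ω, ∫⁻ y, F (ω, y) ∂(κ ω) ∂μ

/-- The joint law of `(T, X)` and the composition product agree on rectangles, hence are equal. No
regularity of `E` is needed because the kernel is given. -/
lemma lintegral_eq_of_rect {Ω' : Type*} [MeasurableSpace Ω'] {μ : Measure Ω}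
    [IsProbabilityMeasure μ] {T : Ω → Ω'} (hT : Measurable T) {X : Ω → E} (hX : Measurable X)
    (κ : Kernel Ω' E) [IsMarkovKernel κ]
    (h : ∀ B, MeasurableSet B → ∀ s, MeasurableSet s →
      μ (T ⁻¹' B ∩ X ⁻¹' s) = ∫⁻ ω in T ⁻¹' B, κ (T ω) s ∂μ)
    {F : Ω' × E → ℝ≥0∞} (hF : Measurable F) :
    ∫⁻ ω, F (T ω, X ω) ∂μ = ∫⁻ ω, ∫⁻ y, F (T ω, y) ∂(κ (T ω)) ∂μ := by
  have : IsProbabilityMeasure (μ.map T) := Measure.isProbabilityMeasure_map hT.aemeasurable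
  have : IsProbabilityMeasure (μ.map fun ω => (T ω, X ω)) :=
    Measure.isProbabilityMeasure_map (hT.prodMk hX).aemeasurable
  have hmeas : μ.map (fun ω => (T ω, X ω)) = μ.map T ⊗ₘ κ := by
    refine Measure.ext_prod fun {B s} hB hs => ?_
    rw [Measure.map_apply (hT.prodMk hX) (hB.prod hs), Measure.compProd_apply_prod hB hs,
      setLIntegral_map hB (κ.measurable_coe hs) hT, ← h B hB s hs]
    rfl
  rw [← lintegral_map hF (hT.prodMk hX), hmeas, Measure.lintegral_compProd hF,
    lintegral_map hF.lintegral_kernel_prod_right' hT]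

lemma isCondLaw_of_rect {μ : Measure Ω} [IsProbabilityMeasure μ]
    (hm : m ≤ mΩ) {X : Ω → E} (hX : Measurable X) {κ : Ω → Measure E} (hκ : Measurable[m] κ)
    (hκ1 : ∀ ω, IsProbabilityMeasure (κ ω))
    (h : ∀ B, MeasurableSet[m] B → ∀ s, MeasurableSet s →
      μ (B ∩ X ⁻¹' s) = ∫⁻ ω in B, κ ω s ∂μ) : IsCondLaw m μ X κ := by
  intro F hF
  let K : @Kernel Ω E m mE := @Kernel.mk Ω E m mE κ hκ
  have : @IsMarkovKernel Ω E m mE K := @IsMarkovKernel.mk Ω E m mE K hκ1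
  -- `T` is the identity, from `Ω` with the full σ-algebra to `Ω` with the coarser `m`.
  exact @lintegral_eq_of_rect Ω E mΩ mE Ω m μ _ id (measurable_id'' hm) X hX K this h F hF

/-- Integrating the conditional probability over `B` recovers the joint probability; `q ≤ 1` keeps
the passage between real and extended integrals lossless. -/
lemma setLIntegral_eq_of_condExp {μ : Measure Ω} [IsProbabilityMeasure μ]
    (hm : m ≤ mΩ) {A : Set Ω} (hA : MeasurableSet A) {q : Ω → ℝ≥0∞} (hq1 : ∀ ω, q ω ≤ 1)
    (h : μ[A.indicator (fun _ => (1 : ℝ)) | m] =ᵐ[μ] fun ω => (q ω).toReal)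
    (hq : Measurable[m] q)
    {B : Set Ω} (hB : MeasurableSet[m] B) : μ (B ∩ A) = ∫⁻ ω in B, q ω ∂μ := by
  have hint : Integrable (A.indicator (fun _ => (1 : ℝ))) μ :=
    (integrable_const 1).indicator hA
  have h1 : ∫ ω in B, (q ω).toReal ∂μ = μ.real (B ∩ A) := by
    rw [← setIntegral_congr_ae (hm B hB) (h.mono fun ω hω _ => hω),
      setIntegral_condExp hm hint hB, setIntegral_indicator hA]
    simp
  rw [integral_toReal ((hq.mono hm le_rfl).aemeasurable)
    (Filter.Eventually.of_forall fun ω => (hq1 ω).trans_lt ENNReal.one_lt_top)] at h1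
  have h2 : ∫⁻ ω in B, q ω ∂μ ≠ ⊤ := by
    refine ne_top_of_le_ne_top (b := ∫⁻ ω in B, 1 ∂μ) ?_ (lintegral_mono fun ω => hq1 ω)
    simp
  rw [measureReal_def] at h1
  exact ((ENNReal.toReal_eq_toReal_iff' h2 (measure_ne_top _ _)).1 h1).symm

lemma isCondLaw_of_condExp {μ : Measure Ω} [IsProbabilityMeasure μ]
    (hm : m ≤ mΩ) {X : Ω → E} (hX : Measurable X) {κ : Ω → Measure E} (hκ : Measurable[m] κ)
    (hκ1 : ∀ ω, IsProbabilityMeasure (κ ω))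
    (h : ∀ s, MeasurableSet s → μ[({ω | X ω ∈ s} : Set Ω).indicator (fun _ => (1 : ℝ)) | m]
      =ᵐ[μ] fun ω => (κ ω).real s) : IsCondLaw m μ X κ := by
  refine isCondLaw_of_rect hm hX hκ hκ1 fun B hB s hs => ?_
  exact setLIntegral_eq_of_condExp hm (hX hs) (q := fun ω => κ ω s) (fun ω => prob_le_one)
    (h s hs) ((Measure.measurable_coe hs).comp hκ) hB

/-- For the actions only conditional point masses are known; on a countable space they determine the
measure. -/
lemma isCondLaw_of_condExp_singleton [Countable E] [MeasurableSingletonClass E]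
    {μ : Measure Ω} [IsProbabilityMeasure μ]
    (hm : m ≤ mΩ) {X : Ω → E} (hX : Measurable X) {κ : Ω → Measure E} (hκ : Measurable[m] κ)
    (hκ1 : ∀ ω, IsProbabilityMeasure (κ ω))
    (h : ∀ e, μ[({ω | X ω = e} : Set Ω).indicator (fun _ => (1 : ℝ)) | m]
      =ᵐ[μ] fun ω => (κ ω).real {e}) : IsCondLaw m μ X κ := by
  refine isCondLaw_of_rect hm hX hκ hκ1 fun B hB s hs => ?_
  have hκ' : Measurable κ := hκ.mono hm le_rfl
  have : (μ.restrict B).map X = (μ.restrict B).bind κ := by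
    refine Measure.ext_of_singleton fun e => ?_
    rw [Measure.map_apply hX (measurableSet_singleton e),
      Measure.bind_apply (measurableSet_singleton e) hκ'.aemeasurable,
      Measure.restrict_apply (hX (measurableSet_singleton e)), Set.inter_comm]
    exact setLIntegral_eq_of_condExp hm (hX (measurableSet_singleton e))
      (q := fun ω => κ ω {e}) (fun ω => prob_le_one)
      (h e) ((Measure.measurable_coe (measurableSet_singleton e)).comp hκ) hB
  rw [← Measure.bind_apply hs hκ'.aemeasurable, ← this, Measure.map_apply hX hs,
      Measure.restrict_apply (hX hs), Set.inter_comm]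

/-- One step of an exponential supermartingale. The weight `W` stands for the exponential of the sum
accumulated so far. -/
lemma IsCondLaw.lintegral_mul_exp_le {μ : Measure Ω} {X : Ω → E}
    {κ : Ω → Measure E} (h : IsCondLaw m μ X κ) {y : Ω × E → ℝ} (hy : Measurable[m.prod mE] y)
    (hle : ∀ ω, ∫⁻ e, ENNReal.ofReal (Real.exp (y (ω, e))) ∂(κ ω) ≤ 1) {W : Ω → ℝ≥0∞}
    (hW : Measurable[m] W) :
    ∫⁻ ω, W ω * ENNReal.ofReal (Real.exp (y (ω, X ω))) ∂μ ≤ ∫⁻ ω, W ω ∂μ := by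
  have hy' : Measurable[m.prod mE] fun q : Ω × E => ENNReal.ofReal (Real.exp (y q)) :=
    ENNReal.measurable_ofReal.comp (Real.measurable_exp.comp hy)
  have hW' : Measurable[m.prod mE] fun q : Ω × E => W q.1 :=
    hW.comp (@measurable_fst _ _ m mE)
  rw [h (fun q => W q.1 * ENNReal.ofReal (Real.exp (y q))) (hW'.mul hy')]
  refine lintegral_mono fun ω => ?_
  have hyω : Measurable fun e => ENNReal.ofReal (Real.exp (y (ω, e))) :=
    hy'.comp (@measurable_prodMk_left _ _ m mE ω)
  simp only
  rw [lintegral_const_mul _ hyω]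
  exact mul_le_of_le_one_right' (hle ω)

/-- Exponential supermartingales, for finitely many steps. -/
lemma lintegral_exp_sum_le_one {K : ℕ} {μ : Measure Ω} [IsProbabilityMeasure μ]
    (𝓕 : Fin K → MeasurableSpace Ω) (Y : Fin K → Ω → ℝ)
    (hY : ∀ i k, i < k → Measurable[𝓕 k] (Y i))
    (h : ∀ i, ∀ W : Ω → ℝ≥0∞, Measurable[𝓕 i] W →
      ∫⁻ ω, W ω * ENNReal.ofReal (Real.exp (Y i ω)) ∂μ ≤ ∫⁻ ω, W ω ∂μ) (n : ℕ) (hn : n ≤ K) :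
    ∫⁻ ω, ENNReal.ofReal (Real.exp (∑ i ∈ Finset.univ.filter (fun i : Fin K => (i : ℕ) < n), Y i ω)) ∂μ ≤ 1 := by
  induction n with
  | zero => simp
  | succ n ih =>
    have hnK : n < K := hn
    have hsplit : ∀ ω, ∑ i ∈ Finset.univ.filter (fun i : Fin K => (i : ℕ) < n + 1), Y i ω =
        (∑ i ∈ Finset.univ.filter (fun i : Fin K => (i : ℕ) < n), Y i ω) + Y ⟨n, hnK⟩ ω := by
      intro ω
      have : (Finset.univ.filter fun i : Fin K => (i : ℕ) < n + 1) =
          insert ⟨n, hnK⟩ (Finset.univ.filter fun i : Fin K => (i : ℕ) < n) := by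
        ext i
        simp only [Finset.mem_filter, Finset.mem_univ, true_and, Finset.mem_insert, Fin.ext_iff]
        omega
      rw [this, Finset.sum_insert (by simp), add_comm]
    simp_rw [hsplit, Real.exp_add, ENNReal.ofReal_mul (Real.exp_nonneg _)]
    refine (h ⟨n, hnK⟩ _ ?_).trans (ih hnK.le)
    refine ENNReal.measurable_ofReal.comp (Real.measurable_exp.comp ?_)
    refine Finset.measurable_sum _ fun i hi => hY i _ ?_
    exact (Finset.mem_filter.1 hi).2

/-- Markov's inequality for `exp S`. -/
lemma measure_log_lt_le {μ : Measure Ω} {S : Ω → ℝ} (hS : Measurable S)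
    (h : ∫⁻ ω, ENNReal.ofReal (Real.exp (S ω)) ∂μ ≤ 1) {δ : ℝ} (hδ : 0 < δ) :
    μ {ω | Real.log (1 / δ) < S ω} ≤ ENNReal.ofReal δ := by
  have h1 := mul_meas_ge_le_lintegral₀ (μ := μ)
    (f := fun ω => ENNReal.ofReal (Real.exp (S ω)))
    (by fun_prop) (ENNReal.ofReal (1 / δ))
  have h2 : μ {ω | Real.log (1 / δ) < S ω} ≤
      μ {ω | ENNReal.ofReal (1 / δ) ≤ ENNReal.ofReal (Real.exp (S ω))} := by
    refine measure_mono fun ω hω => ?_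
    refine ENNReal.ofReal_le_ofReal ?_
    rw [← Real.log_le_iff_le_exp (by positivity)]
    exact le_of_lt hω
  have h3 : ENNReal.ofReal (1 / δ) * μ {ω | Real.log (1 / δ) < S ω} ≤ 1 :=
    (mul_le_mul_right h2 _).trans (h1.trans h)
  have h4 : μ {ω | Real.log (1 / δ) < S ω} =
      ENNReal.ofReal δ * (ENNReal.ofReal (1 / δ) * μ {ω | Real.log (1 / δ) < S ω}) := by
    rw [← mul_assoc, ← ENNReal.ofReal_mul hδ.le, mul_one_div_cancel hδ.ne']
    simp
  rw [h4]
  exact mul_le_of_le_one_right' h3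

/-- Hoeffding's lemma: a variable with values in an interval of length `2 * r` has variance proxy `r
^ 2`. -/
lemma lintegral_exp_centered_le_one {ρ : Measure E} [IsProbabilityMeasure ρ] {ψ : E → ℝ}
    (hψ : Measurable ψ) {r : ℝ} (hb : ∀ e, |ψ e| ≤ r) (t : ℝ) :
    ∫⁻ e, ENNReal.ofReal (Real.exp (t * (ψ e - ∫ e', ψ e' ∂ρ) - t ^ 2 * r ^ 2 / 2)) ∂ρ ≤ 1 := by
  have hsub := hasSubgaussianMGF_of_mem_Icc (μ := ρ) (X := ψ) (a := -r) (b := r)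
    hψ.aemeasurable (Filter.Eventually.of_forall fun e => abs_le.1 (hb e))
  have h1 := hsub.mgf_le t
  have h2 := hsub.integrable_exp_mul t
  simp_rw [Real.exp_sub (t * _), div_eq_mul_inv]
  rw [← ofReal_integral_eq_lintegral_ofReal (h2.mul_const _)
    (Filter.Eventually.of_forall fun e => by positivity), integral_mul_const]
  refine ENNReal.ofReal_le_one.2 ?_
  rw [← div_eq_mul_inv, div_le_one (Real.exp_pos _)]
  refine h1.trans (Real.exp_le_exp.2 (le_of_eq ?_))
  simp only [NNReal.coe_pow, NNReal.coe_div, coe_nnnorm, NNReal.coe_ofNat, Real.norm_eq_abs]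
  rw [div_pow, sq_abs]
  ring

/-- On [0, 4], exp(-X/4) ≤ 1 - X/8, and then 1 - I/8 ≤ exp(-I/8). Nonnegativity makes the bound
multiplicative: a sum of conditional means is at most twice the observed sum plus a logarithm, with
no √K term. -/
lemma lintegral_exp_mean_sub_le_one {ρ : Measure E} [IsProbabilityMeasure ρ] {X : E → ℝ}
    (hX : Measurable X) (h0 : ∀ e, 0 ≤ X e) (h4 : ∀ e, X e ≤ 4) :
    ∫⁻ e, ENNReal.ofReal (Real.exp ((∫ e', X e' ∂ρ) / 8 - X e / 4)) ∂ρ ≤ 1 := by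
  have hint : Integrable X ρ := Integrable.of_bound hX.aestronglyMeasurable 4
    (Filter.Eventually.of_forall fun e => by rw [Real.norm_of_nonneg (h0 e)]; exact h4 e)
  set I := ∫ e', X e' ∂ρ with hI
  have hpt : ∀ e, Real.exp (I / 8 - X e / 4) ≤ Real.exp (I / 8) * (1 - X e / 8) := by
    intro e
    rw [sub_eq_add_neg, Real.exp_add]
    refine mul_le_mul_of_nonneg_left ?_ (Real.exp_nonneg _)
    have hu0 := h0 e
    have hu4 := h4 e
    have h1 : X e / 4 + 1 ≤ Real.exp (X e / 4) := Real.add_one_le_exp _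
    rw [Real.exp_neg, inv_le_comm₀ (Real.exp_pos _) (by linarith)]
    refine le_trans ?_ h1
    rw [inv_le_iff_one_le_mul₀ (by linarith)]
    nlinarith
  calc ∫⁻ e, ENNReal.ofReal (Real.exp (I / 8 - X e / 4)) ∂ρ
      ≤ ∫⁻ e, ENNReal.ofReal (Real.exp (I / 8) * (1 - X e / 8)) ∂ρ :=
        lintegral_mono fun e => ENNReal.ofReal_le_ofReal (hpt e)
    _ = ENNReal.ofReal (∫ e, Real.exp (I / 8) * (1 - X e / 8) ∂ρ) := by
        refine (ofReal_integral_eq_lintegral_ofReal ?_ ?_).symm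
        · exact ((integrable_const _).sub (hint.div_const _)).const_mul _
        · refine Filter.Eventually.of_forall fun e => mul_nonneg (Real.exp_nonneg _) ?_
          have := h4 e
          linarith
    _ ≤ 1 := by
        refine ENNReal.ofReal_le_one.2 ?_
        rw [integral_const_mul, integral_sub (integrable_const _) (hint.div_const _),
          integral_div]
        simp only [integral_const, probReal_univ, smul_eq_mul, mul_one, ← hI]
        calc Real.exp (I / 8) * (1 - I / 8) ≤ Real.exp (I / 8) * Real.exp (-(I / 8)) := by
              refine mul_le_mul_of_nonneg_left ?_ (Real.exp_nonneg _)
              have := Real.add_one_le_exp (-(I / 8))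
              linarith
          _ = 1 := by rw [← Real.exp_add]; simp

end Concentration

/-! ### Integrals of bounded functions -/

section BoundedIntegrals

variable {E E' : Type*} [MeasurableSpace E] [MeasurableSpace E'] {ρ : Measure E}

lemma integrable_of_abs_le [IsFiniteMeasure ρ] {f : E → ℝ} (hf : Measurable f) {c : ℝ}
    (hb : ∀ e, |f e| ≤ c) : Integrable f ρ :=
  Integrable.of_bound hf.aestronglyMeasurable c (Filter.Eventually.of_forall hb)

lemma abs_integral_le_of_abs_le [IsProbabilityMeasure ρ] {f : E → ℝ} {c : ℝ}
    (hb : ∀ e, |f e| ≤ c) : |∫ e, f e ∂ρ| ≤ c := by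
  have := norm_integral_le_of_norm_le_const (μ := ρ) (f := f) (C := c)
    (Filter.Eventually.of_forall hb)
  simpa using this

lemma abs_integral_sub_le_of_abs_le [IsProbabilityMeasure ρ] {f g : E → ℝ} {c : ℝ}
    (hf : Integrable f ρ) (hg : Integrable g ρ) (hb : ∀ e, |f e - g e| ≤ c) :
    |∫ e, f e ∂ρ - ∫ e, g e ∂ρ| ≤ c := by
  rw [← integral_sub hf hg]
  exact abs_integral_le_of_abs_le hb

lemma integral_bind_kernel [IsFiniteMeasure ρ] (κ : Kernel E E') [IsMarkovKernel κ] {f : E' → ℝ}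
    (hf : Measurable f) {c : ℝ} (hb : ∀ e, |f e| ≤ c) :
    ∫ y, f y ∂(ρ.bind κ) = ∫ x, ∫ y, f y ∂(κ x) ∂ρ := by
  have := Kernel.integral_comp (κ := Kernel.const Unit ρ) (η := κ) (a := ()) (f := f) (by
    exact integrable_of_abs_le hf hb)
  simpa [Kernel.comp_apply] using this

lemma measurable_of_measurable_real_singleton {T A : Type*} [MeasurableSpace T]
    [MeasurableSpace A] [Finite A] [MeasurableSingletonClass A] {κ : T → Measure A}
    (hκ : ∀ t, IsProbabilityMeasure (κ t)) (h : ∀ a, Measurable fun t => (κ t).real {a}) :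
    Measurable κ := by
  have := Fintype.ofFinite A
  refine Measure.measurable_of_measurable_coe _ fun s _ => ?_
  have : ∀ t, κ t s = ∑ a ∈ s.toFinite.toFinset, ENNReal.ofReal ((κ t).real {a}) := by
    intro t
    simp only [measureReal_def, ENNReal.ofReal_toReal (measure_ne_top _ _)]
    rw [sum_measure_singleton]
    simp
  simp_rw [this]
  exact Finset.measurable_sum _ fun a _ => (h a).ennreal_ofReal

end BoundedIntegrals

/-! ### Expected values under a pair of step policies -/

section Evaluation

variable {S A : Type*} [MeasurableSpace S] [MeasurableSpace A] {H : ℕ}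

instance (π : StepPolicy S A) : IsMarkovKernel π.1 := π.2

instance (G : Game S A H) (h : Fin H) : IsMarkovKernel (G.trans h) := G.trans_markov h

variable [Finite A] [MeasurableSingletonClass A]

lemma evalQ_eq_integral (f : S × A × A → ℝ) (π ν : StepPolicy S A) (x : S) :
    evalQ f π ν x = ∫ ab, f (x, ab) ∂((π.1 ×ₖ ν.1) x) := by
  rw [Kernel.prod_apply, integral_prod _ Integrable.of_finite]
  rfl

/-- With the second player's action outermost, the integrand is the quantity in which the metric on
Π is measured. -/
lemma evalQ_eq_integral_evalQLeft (f : S × A × A → ℝ) (π ν : StepPolicy S A) (x : S) :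
    evalQ f π ν x = ∫ b, evalQLeft f π x b ∂(ν.1 x) := by
  rw [evalQ_eq_integral, Kernel.prod_apply, integral_prod_symm _ Integrable.of_finite]
  rfl

lemma evalQ_eq_sum [Fintype A] (f : S × A × A → ℝ) (π ν : StepPolicy S A) (x : S) :
    evalQ f π ν x = ∑ a, (π.1 x).real {a} * ∑ b, (ν.1 x).real {b} * f (x, a, b) := by
  unfold evalQ
  rw [integral_fintype Integrable.of_finite]
  refine Finset.sum_congr rfl fun a _ => ?_
  rw [integral_fintype Integrable.of_finite]
  rfl

lemma abs_evalQ_le {f : S × A × A → ℝ} {c : ℝ} (hf : ∀ z, |f z| ≤ c) (π ν : StepPolicy S A)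
    (x : S) : |evalQ f π ν x| ≤ c := by
  rw [evalQ_eq_integral]
  exact abs_integral_le_of_abs_le fun _ => hf _

lemma abs_evalQ_sub_le {f g : S × A × A → ℝ} {c : ℝ} (hf : ∀ z, |f z - g z| ≤ c)
    (π ν : StepPolicy S A) (x : S) : |evalQ f π ν x - evalQ g π ν x| ≤ c := by
  rw [evalQ_eq_integral, evalQ_eq_integral]
  exact abs_integral_sub_le_of_abs_le Integrable.of_finite Integrable.of_finite fun _ => hf _

lemma abs_evalQ_sub_le_of_evalQLeft {f : S × A × A → ℝ} {c : ℝ} {π π' : StepPolicy S A} {x : S}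
    (hf : ∀ b, |evalQLeft f π x b - evalQLeft f π' x b| ≤ c)
    (ν : StepPolicy S A) : |evalQ f π ν x - evalQ f π' ν x| ≤ c := by
  rw [evalQ_eq_integral_evalQLeft, evalQ_eq_integral_evalQLeft]
  exact abs_integral_sub_le_of_abs_le Integrable.of_finite Integrable.of_finite fun _ => hf _

lemma measurable_evalQ {f : S × A × A → ℝ} (hf : Measurable f) (π ν : StepPolicy S A) :
    Measurable (evalQ f π ν) := by
  have : evalQ f π ν = fun x => ∫ ab, f (x, ab) ∂((π.1 ×ₖ ν.1) x) :=
    funext fun x => evalQ_eq_integral f π ν x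
  rw [this]
  exact (hf.stronglyMeasurable.integral_kernel_prod_right').measurable

lemma abs_stageValue_le {f : QSeq S A H} {c : ℝ} (hc : 0 ≤ c) (hf : ∀ h z, |f h z| ≤ c)
    (π ν : Policy S A H) (n : ℕ) (x : S) : |stageValue f π ν n x| ≤ c := by
  unfold stageValue
  split_ifs
  · exact abs_evalQ_le (hf _) _ _ _
  · simpa using hc

lemma measurable_stageValue {f : QSeq S A H} (hf : ∀ h, Measurable (f h))
    (π ν : Policy S A H) (n : ℕ) : Measurable (stageValue f π ν n) := by
  unfold stageValue
  split_ifs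
  · exact measurable_evalQ (hf _) _ _
  · exact measurable_const

end Evaluation

/-! ### Best responses and stability of the minimum -/

section BestResponse

variable {S A : Type*} [MeasurableSpace S] [MeasurableSpace A] {H : ℕ}
  {F : Fin H → Set (S × A × A → ℝ)} {P : Fin H → Set (StepPolicy S A)}
  {br : Fin H → (S × A × A → ℝ) → StepPolicy S A → StepPolicy S A}

lemma bestResponse_mem (hbr : IsBestResponseMap F P br) {f : QSeq S A H} (hf : f ∈ prodClass F)
    {π : Policy S A H} (hπ : π ∈ prodClass P) : bestResponse br f π ∈ prodClass P :=
  fun h => (hbr h _ (hf h) _ (hπ h)).1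

lemma minValue_eq_stageValue (hbr : IsBestResponseMap F P br) {f : QSeq S A H}
    (hf : f ∈ prodClass F) {π : Policy S A H} (hπ : π ∈ prodClass P) (n : ℕ) (x : S) :
    minValue P f π n x = stageValue f π (bestResponse br f π) n x := by
  unfold minValue stageValue
  split_ifs with hn
  · obtain ⟨h1, h2⟩ := hbr ⟨n, hn⟩ _ (hf _) _ (hπ _)
    have : Nonempty (P ⟨n, hn⟩) := ⟨⟨_, h1⟩⟩
    refine le_antisymm (ciInf_le ⟨evalQ (f ⟨n, hn⟩) (π ⟨n, hn⟩)
      (br ⟨n, hn⟩ (f ⟨n, hn⟩) (π ⟨n, hn⟩)) x, ?_⟩ (⟨_, h1⟩ : P ⟨n, hn⟩))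
      (le_ciInf fun ν => h2 _ ν.2 x)
    rintro _ ⟨ν, rfl⟩
    exact h2 _ ν.2 x
  · rfl

lemma minValue_le_stageValue (hbr : IsBestResponseMap F P br) {f : QSeq S A H}
    (hf : f ∈ prodClass F) {π ν : Policy S A H} (hπ : π ∈ prodClass P) (hν : ν ∈ prodClass P)
    (n : ℕ) (x : S) : minValue P f π n x ≤ stageValue f π ν n x := by
  rw [minValue_eq_stageValue hbr hf hπ]
  unfold stageValue
  split_ifs with hn
  · exact (hbr ⟨n, hn⟩ _ (hf _) _ (hπ _)).2 _ (hν _) x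
  · rfl

variable [Finite A] [MeasurableSingletonClass A]

lemma abs_minValue_le (hF : IsBoundedClass F) (hbr : IsBestResponseMap F P br) {f : QSeq S A H}
    (hf : f ∈ prodClass F) {π : Policy S A H} (hπ : π ∈ prodClass P) (n : ℕ) (x : S) :
    |minValue P f π n x| ≤ 1 := by
  rw [minValue_eq_stageValue hbr hf hπ]
  exact abs_stageValue_le zero_le_one (fun h => (hF h _ (hf h)).2) _ _ _ _

lemma measurable_minValue (hF : IsBoundedClass F) (hbr : IsBestResponseMap F P br)
    {f : QSeq S A H} (hf : f ∈ prodClass F) {π : Policy S A H} (hπ : π ∈ prodClass P) (n : ℕ) :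
    Measurable (minValue P f π n) := by
  have : minValue P f π n = stageValue f π (bestResponse br f π) n :=
    funext fun x => minValue_eq_stageValue hbr hf hπ n x
  rw [this]
  exact measurable_stageValue (fun h => (hF h _ (hf h)).1) _ _ _

/-- Best responses to nearby pairs may be far apart, but the minima are not: against `(f, π)` play
the best response to `(f', π')`, then exchange the policy and the function at cost `ε` each. -/
lemma minValue_le_minValue_add (hbr : IsBestResponseMap F P br)
    {f f' : QSeq S A H} (hf : f ∈ prodClass F) (hf' : f' ∈ prodClass F)
    {π π' : Policy S A H} (hπ : π ∈ prodClass P) (hπ' : π' ∈ prodClass P) {ε : ℝ} (hε : 0 ≤ ε)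
    (hff : ∀ h z, |f h z - f' h z| ≤ ε)
    (hππ : ∀ h x b, |evalQLeft (f h) (π h) x b - evalQLeft (f h) (π' h) x b| ≤ ε)
    (n : ℕ) (x : S) : minValue P f π n x ≤ minValue P f' π' n x + 2 * ε := by
  refine (minValue_le_stageValue hbr hf hπ (bestResponse_mem hbr hf' hπ') n x).trans ?_
  rw [minValue_eq_stageValue hbr hf' hπ']
  unfold stageValue
  split_ifs with hn
  · have h1 := abs_le.1 (abs_evalQ_sub_le_of_evalQLeft (hππ ⟨n, hn⟩ x)
      (bestResponse br f' π' ⟨n, hn⟩))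
    have h2 := abs_le.1 (abs_evalQ_sub_le (hff ⟨n, hn⟩) (π' ⟨n, hn⟩)
      (bestResponse br f' π' ⟨n, hn⟩) x)
    linarith [h1.2, h2.2]
  · linarith

lemma abs_minValue_sub_le (hbr : IsBestResponseMap F P br)
    {f f' : QSeq S A H} (hf : f ∈ prodClass F) (hf' : f' ∈ prodClass F)
    {π π' : Policy S A H} (hπ : π ∈ prodClass P) (hπ' : π' ∈ prodClass P) {ε : ℝ} (hε : 0 ≤ ε)
    (hff : ∀ h z, |f h z - f' h z| ≤ ε)
    (hππ : ∀ h, ∀ g ∈ F h, ∀ x b, |evalQLeft g (π h) x b - evalQLeft g (π' h) x b| ≤ ε)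
    (n : ℕ) (x : S) : |minValue P f π n x - minValue P f' π' n x| ≤ 2 * ε := by
  have h1 := minValue_le_minValue_add hbr hf hf' hπ hπ' hε hff
    (fun h => hππ h _ (hf h)) n x
  have h2 := minValue_le_minValue_add hbr hf' hf hπ' hπ hε
    (fun h z => by rw [abs_sub_comm]; exact hff h z)
    (fun h x b => by rw [abs_sub_comm]; exact hππ h _ (hf' h) x b) n x
  rw [abs_le]
  constructor <;> linarith

end BestResponse

/-! ### Bellman residuals and fixed points -/

section Residuals

variable {S A : Type*} [MeasurableSpace S] [MeasurableSpace A] {H : ℕ} (G : Game S A H)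

/-- The residual of `f` at step `h` when both players follow fixed policies. -/
noncomputable def policyResidual (π ν : Policy S A H) (f : QSeq S A H) (h : Fin H) (z : S × A × A) : ℝ :=
  f h z - (G.reward h z + ∫ x', stageValue f π ν (h + 1) x' ∂(G.trans h z))

variable {G}

variable {F : Fin H → Set (S × A × A → ℝ)} {P : Fin H → Set (StepPolicy S A)}
  {br : Fin H → (S × A × A → ℝ) → StepPolicy S A → StepPolicy S A}

lemma policyResidual_bestResponse (hbr : IsBestResponseMap F P br)
    {f : QSeq S A H} (hf : f ∈ prodClass F) {π : Policy S A H} (hπ : π ∈ prodClass P)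
    (h : Fin H) (z : S × A × A) :
    policyResidual G π (bestResponse br f π) f h z = f h z - bellman G P π f h z := by
  unfold policyResidual bellman
  simp_rw [minValue_eq_stageValue hbr hf hπ]

/-- The operator at step `h` reads only entry `h + 1`. Backward recursion, and the replacement of
entry `h` by a competitor, both rest on this. -/
lemma bellman_congr {π : Policy S A H} {f f' : QSeq S A H} {h : Fin H}
    (hff : ∀ h' : Fin H, (h' : ℕ) = h + 1 → f h' = f' h') :
    bellman G P π f h = bellman G P π f' h := by
  have : minValue P f π (h + 1) = minValue P f' π (h + 1) := by
    unfold minValue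
    split_ifs with hn
    · rw [hff ⟨h + 1, hn⟩ rfl]
    · rfl
  unfold bellman
  rw [this]

/-- Completeness yields a fixed point of the Bellman operators inside the class. -/
lemma exists_bellman_fixedPoint (hcomp : StrongCompleteness G F P)
    (hne : (prodClass F).Nonempty) {π : Policy S A H} (hπ : π ∈ prodClass P) :
    ∃ Q ∈ prodClass F, ∀ h, bellman G P π Q h = Q h := by
  have key : ∀ n, n ≤ H → ∃ Q ∈ prodClass F,
      ∀ h : Fin H, H - n ≤ (h : ℕ) → bellman G P π Q h = Q h := by
    intro n
    induction n with
    | zero =>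
      intro _
      obtain ⟨f, hf⟩ := hne
      exact ⟨f, hf, fun h hh => absurd h.2 (by omega)⟩
    | succ n ih =>
      intro hn
      obtain ⟨Q, hQ, hfix⟩ := ih (by omega)
      have hlt : H - (n + 1) < H := by omega
      -- Overwriting entry `H - (n + 1)` makes that step a fixed point and does not disturb the
      -- later ones, whose operators read only entries further on.
      refine ⟨Function.update Q ⟨H - (n + 1), hlt⟩ (bellman G P π Q ⟨H - (n + 1), hlt⟩), ?_, ?_⟩
      · intro h
        by_cases hh : h = ⟨H - (n + 1), hlt⟩
        · subst hh
          rw [Function.update_self]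
          exact hcomp π hπ Q hQ _
        · rw [Function.update_of_ne hh]
          exact hQ h
      · intro h hh
        have e : bellman G P π (Function.update Q ⟨H - (n + 1), hlt⟩
            (bellman G P π Q ⟨H - (n + 1), hlt⟩)) h = bellman G P π Q h := by
          refine bellman_congr fun h' hh' => Function.update_of_ne ?_ _ _
          rintro rfl
          simp only at hh'
          omega
        rw [e]
        by_cases hh2 : h = ⟨H - (n + 1), hlt⟩
        · subst hh2
          rw [Function.update_self]
        · rw [Function.update_of_ne hh2]
          refine hfix h ?_
          have : (h : ℕ) ≠ H - (n + 1) := fun h3 => hh2 (Fin.ext h3)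
          omega
  obtain ⟨Q, hQ, hfix⟩ := key H le_rfl
  exact ⟨Q, hQ, fun h => hfix h (by omega)⟩

end Residuals

/-! ### Laws of trajectories and the telescoping identity -/

section Laws

variable {S A : Type*} [MeasurableSpace S] [MeasurableSpace A] {H : ℕ} (G : Game S A H)

lemma stateLaw_succ (π ν : Policy S A H) (m : Measure S) {n : ℕ} (hn : n < H) :
    stateLaw G π ν m 0 (n + 1) =
      (stateActionLaw (stateLaw G π ν m 0 n) (π ⟨n, hn⟩) (ν ⟨n, hn⟩)).bind
        (G.trans ⟨n, hn⟩) := by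
  rw [stateLaw, dif_pos (by omega : 0 + n < H)]
  simp only [zero_add]

lemma occupancy_zero (π ν : Policy S A H) (m : Measure S) (h : Fin H) :
    occupancy G π ν m 0 h = stateActionLaw (stateLaw G π ν m 0 h) (π h) (ν h) := rfl

instance (m : Measure S) [IsProbabilityMeasure m] (π ν : StepPolicy S A) :
    IsProbabilityMeasure (stateActionLaw m π ν) := by
  unfold stateActionLaw; infer_instance

lemma isProbabilityMeasure_stateLaw (π ν : Policy S A H) (m : Measure S)
    [IsProbabilityMeasure m] (n : ℕ) (hn : n ≤ H) :
    IsProbabilityMeasure (stateLaw G π ν m 0 n) := by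
  induction n with
  | zero => rw [stateLaw]; infer_instance
  | succ n ih =>
    have := ih (by omega)
    rw [stateLaw_succ G π ν m (by omega : n < H)]
    infer_instance

instance (π ν : Policy S A H) (m : Measure S) [IsProbabilityMeasure m] (h : Fin H) :
    IsProbabilityMeasure (occupancy G π ν m 0 h) := by
  have := isProbabilityMeasure_stateLaw G π ν m h h.2.le
  rw [occupancy_zero]
  infer_instance

variable [Finite A] [MeasurableSingletonClass A]

lemma integral_stateActionLaw {m : Measure S} [IsProbabilityMeasure m] (π ν : StepPolicy S A)
    {f : S × A × A → ℝ} (hf : Measurable f) {c : ℝ} (hb : ∀ z, |f z| ≤ c) :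
    ∫ z, f z ∂(stateActionLaw m π ν) = ∫ x, evalQ f π ν x ∂m := by
  unfold stateActionLaw
  rw [Measure.integral_compProd (integrable_of_abs_le hf hb)]
  simp_rw [← evalQ_eq_integral]

variable {G}

lemma measurable_policyResidual {f : QSeq S A H} (hf : ∀ h, Measurable (f h))
    (π ν : Policy S A H) (h : Fin H) : Measurable (policyResidual G π ν f h) := by
  refine (hf h).sub ((G.reward_meas h).add ?_)
  exact ((measurable_stageValue hf π ν _).comp measurable_snd).stronglyMeasurable
    |>.integral_kernel_prod_right'.measurable

lemma abs_policyResidual_le {f : QSeq S A H} (hb : ∀ h z, |f h z| ≤ 1)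
    (π ν : Policy S A H) (h : Fin H) (z : S × A × A) : |policyResidual G π ν f h z| ≤ 3 := by
  have h1 := abs_le.1 (hb h z)
  have h2 := abs_le.1 (G.reward_bdd h z)
  have h3 := abs_le.1 (abs_integral_le_of_abs_le (ρ := G.trans h z)
    (abs_stageValue_le zero_le_one hb π ν (h + 1)))
  unfold policyResidual
  rw [abs_le]
  constructor <;> linarith [h1.1, h1.2, h2.1, h2.2, h3.1, h3.2]

/-- The value is the initial estimate corrected by the expected residuals. -/
lemma sum_integral_policyResidual {f : QSeq S A H} (hf : ∀ h, Measurable (f h))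
    (hb : ∀ h z, |f h z| ≤ 1) (π ν : Policy S A H) :
    ∑ h, ∫ z, policyResidual G π ν f h z ∂(occupancy G π ν (Measure.dirac G.init) 0 h) =
      stageValue f π ν 0 G.init - value G π ν 0 G.init := by
  set m := Measure.dirac G.init with hm
  -- `U n` is the expected estimate at step `n`. Each expected residual is `U h - U (h + 1)` minus
  -- the expected reward, and `U H = 0`.
  set U : ℕ → ℝ := fun n => ∫ x, stageValue f π ν n x ∂(stateLaw G π ν m 0 n) with hU
  have hU0 : U 0 = stageValue f π ν 0 G.init := by
    simp only [hU, stateLaw, hm]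
    exact integral_dirac' _ _ (measurable_stageValue hf π ν 0).stronglyMeasurable
  have hUH : U H = 0 := by simp [hU, stageValue]
  have hstep : ∀ h : Fin H, ∫ z, policyResidual G π ν f h z ∂(occupancy G π ν m 0 h) =
      U h - U (h + 1) - ∫ z, G.reward h z ∂(occupancy G π ν m 0 h) := by
    intro h
    have := isProbabilityMeasure_stateLaw G π ν m h h.2.le
    have e1 : ∫ z, f h z ∂(occupancy G π ν m 0 h) = U h := by
      rw [occupancy_zero, integral_stateActionLaw _ _ (hf h) (hb h)]
      simp [hU, stageValue]
    have e2 : ∫ z, ∫ x', stageValue f π ν (h + 1) x' ∂(G.trans h z) ∂(occupancy G π ν m 0 h) =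
        U (h + 1) := by
      simp only [hU]
      rw [stateLaw_succ G π ν m h.2, ← integral_bind_kernel (G.trans h)
        (measurable_stageValue hf π ν _) (abs_stageValue_le zero_le_one hb π ν _)]
      rfl
    have i1 : Integrable (f h) (occupancy G π ν m 0 h) := integrable_of_abs_le (hf h) (hb h)
    have i2 : Integrable (G.reward h) (occupancy G π ν m 0 h) :=
      integrable_of_abs_le (G.reward_meas h) (G.reward_bdd h)
    have i3 : Integrable (fun z => ∫ x', stageValue f π ν (h + 1) x' ∂(G.trans h z))
        (occupancy G π ν m 0 h) :=
      integrable_of_abs_le (((measurable_stageValue hf π ν _).comp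
        measurable_snd).stronglyMeasurable.integral_kernel_prod_right'.measurable)
        fun z => abs_integral_le_of_abs_le (abs_stageValue_le zero_le_one hb π ν _)
    unfold policyResidual
    have i4 : Integrable (fun z => G.reward h z +
        ∫ x', stageValue f π ν (h + 1) x' ∂(G.trans h z)) (occupancy G π ν m 0 h) := i2.add i3
    rw [integral_sub i1 i4, integral_add i2 i3, e1, e2]
    ring
  simp_rw [hstep]
  rw [Finset.sum_sub_distrib, Fin.sum_univ_eq_sum_range (fun n => U n - U (n + 1)),
    Finset.sum_range_sub', hU0, hUH]
  simp [value, expectedReward, hm]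

variable {F : Fin H → Set (S × A × A → ℝ)} {P : Fin H → Set (StepPolicy S A)}
  {br : Fin H → (S × A × A → ℝ) → StepPolicy S A → StepPolicy S A}

/-- A fixed `ν` gives a next-step value at least the minimum, and this value enters with a minus
sign. -/
lemma policyResidual_le (hF : IsBoundedClass F) (hbr : IsBestResponseMap F P br)
    {f : QSeq S A H} (hf : f ∈ prodClass F) {π ν : Policy S A H} (hπ : π ∈ prodClass P)
    (hν : ν ∈ prodClass P) (h : Fin H) (z : S × A × A) :
    policyResidual G π ν f h z ≤ f h z - bellman G P π f h z := by
  unfold policyResidual bellman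
  have : ∫ x', minValue P f π (h + 1) x' ∂(G.trans h z) ≤
      ∫ x', stageValue f π ν (h + 1) x' ∂(G.trans h z) := by
    refine integral_mono
      (integrable_of_abs_le (measurable_minValue hF hbr hf hπ _) (abs_minValue_le hF hbr hf hπ _))
      (integrable_of_abs_le (measurable_stageValue (fun h => (hF h _ (hf h)).1) _ _ _)
        (abs_stageValue_le zero_le_one (fun h => (hF h _ (hf h)).2) _ _ _))
      fun x => minValue_le_stageValue hbr hf hπ hν _ x
  linarith

/-- Against any `ν` the on-policy residuals of the fixed point are nonpositive, so telescoping
bounds the value below by the estimate. Against the best response to `Q` they vanish and the bound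
is attained. -/
lemma worstValue_eq_initValue (hF : IsBoundedClass F) (hbr : IsBestResponseMap F P br)
    {π : Policy S A H} (hπ : π ∈ prodClass P) {Q : QSeq S A H} (hQ : Q ∈ prodClass F)
    (hfix : ∀ h, bellman G P π Q h = Q h) : worstValue G P π = initValue G br (π, Q) := by
  have hm : ∀ h, Measurable (Q h) := fun h => (hF h _ (hQ h)).1
  have hb : ∀ h z, |Q h z| ≤ 1 := fun h => (hF h _ (hQ h)).2
  have hge : ∀ ν ∈ prodClass P, initValue G br (π, Q) ≤ value G π ν 0 G.init := by
    intro ν hν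
    have h1 := sum_integral_policyResidual (G := G) hm hb π ν
    have h2 : ∑ h, ∫ z, policyResidual G π ν Q h z
        ∂(occupancy G π ν (Measure.dirac G.init) 0 h) ≤ 0 := by
      refine Finset.sum_nonpos fun h _ => integral_nonpos fun z => ?_
      refine (policyResidual_le hF hbr hQ hπ hν h z).trans ?_
      rw [hfix]
      simp
    have h3 := minValue_le_stageValue hbr hQ hπ hν 0 G.init
    rw [minValue_eq_stageValue hbr hQ hπ] at h3
    unfold initValue
    simp only
    linarith
  have hmem := bestResponse_mem hbr hQ hπ
  have heq : value G π (bestResponse br Q π) 0 G.init = initValue G br (π, Q) := by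
    have h1 := sum_integral_policyResidual (G := G) hm hb π (bestResponse br Q π)
    simp_rw [policyResidual_bestResponse hbr hQ hπ, hfix] at h1
    simp only [sub_self, integral_zero, Finset.sum_const_zero] at h1
    unfold initValue
    simp only
    linarith
  have : Nonempty (prodClass P) := ⟨⟨_, hmem⟩⟩
  refine le_antisymm ?_ (le_ciInf fun ν => hge _ ν.2)
  rw [← heq]
  refine ciInf_le (f := fun ν : prodClass P => value G π ν.1 0 G.init) ⟨initValue G br (π, Q), ?_⟩
    ⟨_, hmem⟩
  rintro _ ⟨ν, rfl⟩
  exact hge _ ν.2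

end Laws

/-! ### Measurable dependence of laws and residuals on a parameter -/

section JointMeasurability

variable {S A : Type*} [MeasurableSpace S] [MeasurableSpace A] [Finite A]
  [MeasurableSingletonClass A] {H : ℕ} {G : Game S A H} {T : Type*} [MeasurableSpace T]
  {π ν : T → Policy S A H}

/-- In the application `T` is the sample space with the σ-algebra of past episodes: the executed
policies are random, and their laws must be kernels in that randomness. -/
lemma measurable_actionLaw
    (hπ : ∀ h (a : A), Measurable fun q : T × S => ((π q.1 h).1 q.2).real {a})
    (hν : ∀ h (a : A), Measurable fun q : T × S => ((ν q.1 h).1 q.2).real {a}) (h : Fin H) :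
    Measurable fun q : T × S => ((π q.1 h).1 ×ₖ (ν q.1 h).1) q.2 := by
  let κ : Kernel (T × S) A := ⟨fun q => (π q.1 h).1 q.2,
    measurable_of_measurable_real_singleton (fun _ => inferInstance) (hπ h)⟩
  let η : Kernel (T × S) A := ⟨fun q => (ν q.1 h).1 q.2,
    measurable_of_measurable_real_singleton (fun _ => inferInstance) (hν h)⟩
  have : IsMarkovKernel κ := ⟨fun q => (inferInstance : IsProbabilityMeasure ((π q.1 h).1 q.2))⟩
  have : IsMarkovKernel η := ⟨fun q => (inferInstance : IsProbabilityMeasure ((ν q.1 h).1 q.2))⟩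
  have e : (fun q : T × S => ((π q.1 h).1 ×ₖ (ν q.1 h).1) q.2) = κ ×ₖ η := by
    funext q
    rw [Kernel.prod_apply, Kernel.prod_apply]
    rfl
  rw [e]
  exact Kernel.measurable _

lemma measurable_stateActionLaw
    (hπ : ∀ h (a : A), Measurable fun q : T × S => ((π q.1 h).1 q.2).real {a})
    (hν : ∀ h (a : A), Measurable fun q : T × S => ((ν q.1 h).1 q.2).real {a}) (h : Fin H)
    {m : T → Measure S} (hm : Measurable m) (hm1 : ∀ t, IsProbabilityMeasure (m t)) :
    Measurable fun t => stateActionLaw (m t) (π t h) (ν t h) := by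
  let κ : Kernel T S := ⟨m, hm⟩
  let η : Kernel (T × S) (A × A) := ⟨_, measurable_actionLaw hπ hν h⟩
  have : IsMarkovKernel κ := ⟨hm1⟩
  have : IsMarkovKernel η := ⟨fun q =>
    (inferInstance : IsProbabilityMeasure (((π q.1 h).1 ×ₖ (ν q.1 h).1) q.2))⟩
  have e : (fun t => stateActionLaw (m t) (π t h) (ν t h)) = κ ⊗ₖ η := by
    funext t
    rw [Kernel.compProd_apply_eq_compProd_sectR]
    rfl
  rw [e]
  exact Kernel.measurable _

lemma measurable_stateLaw
    (hπ : ∀ h (a : A), Measurable fun q : T × S => ((π q.1 h).1 q.2).real {a})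
    (hν : ∀ h (a : A), Measurable fun q : T × S => ((ν q.1 h).1 q.2).real {a})
    (m : Measure S) [IsProbabilityMeasure m] (n : ℕ) (hn : n ≤ H) :
    Measurable fun t => stateLaw G (π t) (ν t) m 0 n := by
  induction n with
  | zero => simp only [stateLaw]; exact measurable_const
  | succ n ih =>
    have hn' : n < H := hn
    simp_rw [stateLaw_succ G _ _ m hn']
    have h1 := measurable_stateActionLaw hπ hν ⟨n, hn'⟩ (ih hn'.le)
      (fun t => isProbabilityMeasure_stateLaw G _ _ m n hn'.le)
    exact (Measure.measurable_bind' (Kernel.measurable _)).comp h1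

lemma measurable_occupancy
    (hπ : ∀ h (a : A), Measurable fun q : T × S => ((π q.1 h).1 q.2).real {a})
    (hν : ∀ h (a : A), Measurable fun q : T × S => ((ν q.1 h).1 q.2).real {a})
    (m : Measure S) [IsProbabilityMeasure m] (h : Fin H) :
    Measurable fun t => occupancy G (π t) (ν t) m 0 h :=
  measurable_stateActionLaw hπ hν h (measurable_stateLaw hπ hν m h h.2.le)
    fun _ => isProbabilityMeasure_stateLaw G _ _ m h h.2.le

lemma measurable_integral_of_measurable {E : Type*} [MeasurableSpace E] {ρ : T → Measure E}
    (hρ : Measurable ρ) (hρ1 : ∀ t, IsProbabilityMeasure (ρ t)) {ψ : T × E → ℝ}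
    (hψ : Measurable ψ) : Measurable fun t => ∫ e, ψ (t, e) ∂(ρ t) := by
  let κ : Kernel T E := ⟨ρ, hρ⟩
  have : IsMarkovKernel κ := ⟨hρ1⟩
  exact (hψ.stronglyMeasurable.integral_kernel_prod_right' (κ := κ)).measurable

lemma measurable_stageValue_joint {f : T → QSeq S A H}
    (hf : ∀ h, Measurable fun q : T × (S × A × A) => f q.1 h q.2)
    (hπ : ∀ h (a : A), Measurable fun q : T × S => ((π q.1 h).1 q.2).real {a})
    (hν : ∀ h (a : A), Measurable fun q : T × S => ((ν q.1 h).1 q.2).real {a}) (n : ℕ) :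
    Measurable fun q : T × S => stageValue (f q.1) (π q.1) (ν q.1) n q.2 := by
  have := Fintype.ofFinite A
  unfold stageValue
  split_ifs with hn
  · simp_rw [evalQ_eq_sum]
    refine Finset.measurable_sum _ fun a _ => (hπ _ a).mul
      (Finset.measurable_sum _ fun b _ => (hν _ b).mul ?_)
    exact (hf ⟨n, hn⟩).comp (by fun_prop :
      Measurable fun q : T × S => ((q.1, (q.2, a, b)) : T × (S × A × A)))
  · exact measurable_const

lemma measurable_policyResidual_joint {f : T → QSeq S A H}
    (hf : ∀ h, Measurable fun q : T × (S × A × A) => f q.1 h q.2)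
    (hπ : ∀ h (a : A), Measurable fun q : T × S => ((π q.1 h).1 q.2).real {a})
    (hν : ∀ h (a : A), Measurable fun q : T × S => ((ν q.1 h).1 q.2).real {a}) (h : Fin H) :
    Measurable fun q : T × (S × A × A) => policyResidual G (π q.1) (ν q.1) (f q.1) h q.2 := by
  refine (hf h).sub (((G.reward_meas h).comp measurable_snd).add ?_)
  refine measurable_integral_of_measurable (ρ := fun q : T × (S × A × A) => G.trans h q.2)
    ((G.trans h).measurable.comp measurable_snd) (fun _ => inferInstance)
    (ψ := fun r => stageValue (f r.1.1) (π r.1.1) (ν r.1.1) (h + 1) r.2) ?_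
  exact (measurable_stageValue_joint hf hπ hν (h + 1)).comp (by fun_prop :
    Measurable fun r : (T × (S × A × A)) × S => (r.1.1, r.2))

end JointMeasurability

/-! ### Composition of conditional laws -/

section CondLaw

lemma measurable_lintegral_of_measurable {T E : Type*} [MeasurableSpace T] [MeasurableSpace E]
    {ρ : T → Measure E} (hρ : Measurable ρ) (hρ1 : ∀ t, IsProbabilityMeasure (ρ t))
    {F : T × E → ℝ≥0∞} (hF : Measurable F) : Measurable fun t => ∫⁻ e, F (t, e) ∂(ρ t) := by
  let κ : Kernel T E := ⟨ρ, hρ⟩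
  have : IsMarkovKernel κ := ⟨hρ1⟩
  exact hF.lintegral_kernel_prod_right' (κ := κ)

variable {Ω E E' : Type*} {mE : MeasurableSpace E} {mE' : MeasurableSpace E'}
  {m₁ m₂ mΩ : MeasurableSpace Ω}

/-- Iterated conditional laws. -/
lemma IsCondLaw.lintegral_pair {μ : Measure Ω} (h12 : m₁ ≤ m₂) {X : Ω → E} {κ₁ : Ω → Measure E}
    (h₁ : IsCondLaw m₁ μ X κ₁) (hX : Measurable[m₂] X) {Y : Ω → E'} {κ₂ : Ω × E → Measure E'}
    (hκ₂ : Measurable[m₁.prod mE] κ₂) (hκ₂1 : ∀ q, IsProbabilityMeasure (κ₂ q))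
    (h₂ : IsCondLaw m₂ μ Y fun ω => κ₂ (ω, X ω))
    {F : Ω × E × E' → ℝ≥0∞} (hF : Measurable[m₁.prod (mE.prod mE')] F) :
    ∫⁻ ω, F (ω, X ω, Y ω) ∂μ = ∫⁻ ω, ∫⁻ x, ∫⁻ y, F (ω, x, y) ∂(κ₂ (ω, x)) ∂(κ₁ ω) ∂μ := by
  have hmap : Measurable[m₂.prod mE', m₁.prod (mE.prod mE')]
      (fun q : Ω × E' => (q.1, X q.1, q.2)) :=
    ((measurable_id'' h12).comp (@measurable_fst Ω E' m₂ mE')).prodMk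
      ((hX.comp (@measurable_fst Ω E' m₂ mE')).prodMk (@measurable_snd Ω E' m₂ mE'))
  -- The kernel of `Y` depends on the finer history only through `m₁` and `X`. After `Y` is
  -- integrated out, the integrand is therefore a function to which `h₁` applies.
  rw [h₂ (fun q => F (q.1, X q.1, q.2)) (hF.comp hmap)]
  have hmap' : Measurable[(m₁.prod mE).prod mE', m₁.prod (mE.prod mE')]
      (fun q : (Ω × E) × E' => (q.1.1, q.1.2, q.2)) :=
    @MeasurableEquiv.measurable _ _ ((m₁.prod mE).prod mE') (m₁.prod (mE.prod mE'))
      (@MeasurableEquiv.prodAssoc Ω E E' m₁ mE mE')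
  exact h₁ (fun q => ∫⁻ y, F (q.1, q.2, y) ∂(κ₂ q))
    (@measurable_lintegral_of_measurable (Ω × E) E' (m₁.prod mE) mE' κ₂ hκ₂ hκ₂1
      (fun q => F (q.1.1, q.1.2, q.2)) (hF.comp hmap'))

end CondLaw

/-! ### σ-algebras of the observed history -/

section Histories

variable {S A : Type*} [MeasurableSpace S] [MeasurableSpace A] {H K : ℕ}
  {Ω : Type*} {Z : Fin K → Fin H → Ω → S × A × A}

lemma measurable_pastEpisodes {i k : Fin K} (hik : i < k) (h : Fin H) :
    Measurable[pastEpisodes Z k] (Z i h) := by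
  have : MeasurableSpace.comap (Z i h) inferInstance ≤ pastEpisodes Z k :=
    le_iSup_of_le i (le_iSup_of_le hik
      (le_iSup (fun h => MeasurableSpace.comap (Z i h) inferInstance) h))
  exact (comap_measurable (Z i h)).mono this le_rfl

lemma pastEpisodes_mono {i k : Fin K} (hik : i ≤ k) : pastEpisodes Z i ≤ pastEpisodes Z k :=
  iSup₂_le fun j hj => le_iSup₂_of_le j (hj.trans_le hik) le_rfl

lemma pastEpisodes_le_beforeActions (k : Fin K) (h : Fin H) :
    pastEpisodes Z k ≤ beforeActions Z k h :=
  le_sup_of_le_left le_sup_left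

lemma pastEpisodes_le_afterActions (k : Fin K) (h : Fin H) :
    pastEpisodes Z k ≤ afterActions Z k h := le_sup_left

lemma measurable_beforeActions (k : Fin K) (h : Fin H) :
    Measurable[beforeActions Z k h] fun ω => (Z k h ω).1 :=
  (comap_measurable (fun ω => (Z k h ω).1)).mono le_sup_right le_rfl

lemma measurable_afterActions (k : Fin K) (h : Fin H) :
    Measurable[afterActions Z k h] (Z k h) :=
  (comap_measurable (Z k h)).mono (le_sup_of_le_right (le_iSup₂_of_le h le_rfl le_rfl)) le_rfl

variable [mΩ : MeasurableSpace Ω]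

lemma pastEpisodes_le (hZ : ∀ k h, Measurable (Z k h)) (k : Fin K) : pastEpisodes Z k ≤ mΩ :=
  iSup_le fun i => iSup_le fun _ => iSup_le fun h => (hZ i h).comap_le

lemma beforeActions_le (hZ : ∀ k h, Measurable (Z k h)) (k : Fin K) (h : Fin H) :
    beforeActions Z k h ≤ mΩ :=
  sup_le (sup_le (pastEpisodes_le hZ k) (iSup_le fun j => iSup_le fun _ => (hZ k j).comap_le))
    (measurable_fst.comp (hZ k h)).comap_le

lemma afterActions_le (hZ : ∀ k h, Measurable (Z k h)) (k : Fin K) (h : Fin H) :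
    afterActions Z k h ≤ mΩ :=
  sup_le (pastEpisodes_le hZ k) (iSup_le fun j => iSup_le fun _ => (hZ k j).comap_le)

end Histories

/-! ### Conditional laws and deviation bounds along a run -/

section Run

variable {S A : Type*} [MeasurableSpace S] [MeasurableSpace A] {H K : ℕ}

/-- The law of `(x_h, a_h, b_h)` in episode `k`, given the past episodes. -/
noncomputable def episodeLaw {Ω : Type*} (G : Game S A H)
    (br : Fin H → (S × A × A → ℝ) → StepPolicy S A → StepPolicy S A)
    (π : Fin K → Ω → Policy S A H) (g : Fin K → Ω → QSeq S A H) (k : Fin K) (h : Fin H) (ω : Ω) :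
    Measure (S × A × A) :=
  occupancy G (π k ω) (bestResponse br (g k ω) (π k ω)) (Measure.dirac G.init) 0 h

/-- The Bellman residual `f_h - T^π_h f_{h+1}`. -/
noncomputable def bellmanResidual (G : Game S A H) (P : Fin H → Set (StepPolicy S A))
    (q : Policy S A H × QSeq S A H) (h : Fin H) (z : S × A × A) : ℝ :=
  q.2 h z - bellman G P q.1 q.2 h z

/-- The deviation of the regression target from its conditional mean `T^π_h f_{h+1}`. -/
noncomputable def targetNoise (G : Game S A H) (P : Fin H → Set (StepPolicy S A))
    (q : Policy S A H × QSeq S A H) (h : Fin H) (Z : Fin H → S × A × A) : ℝ :=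
  bellman G P q.1 q.2 h (Z h) - G.reward h (Z h) -
    (if hn : (h : ℕ) + 1 < H then minValue P q.2 q.1 (h + 1) (Z ⟨h + 1, hn⟩).1 else 0)

/-- The difference of the on-policy residuals of the optimistic and the pessimistic estimates. -/
noncomputable def residualGap {Ω : Type*} (G : Game S A H)
    (br : Fin H → (S × A × A → ℝ) → StepPolicy S A → StepPolicy S A)
    (π : Fin K → Ω → Policy S A H) (f g : Fin K → Ω → QSeq S A H) (k : Fin K) (h : Fin H)
    (ω : Ω) (z : S × A × A) : ℝ :=
  policyResidual G (π k ω) (bestResponse br (g k ω) (π k ω)) (f k ω) h z -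
    policyResidual G (π k ω) (bestResponse br (g k ω) (π k ω)) (g k ω) h z

variable {G : Game S A H} {F : Fin H → Set (S × A × A → ℝ)} {P : Fin H → Set (StepPolicy S A)}
  {br : Fin H → (S × A × A → ℝ) → StepPolicy S A → StepPolicy S A} {β : ℝ}
  {Ω : Type*} [mΩ : MeasurableSpace Ω] {μ : Measure Ω}
  {Z : Fin K → Fin H → Ω → S × A × A} {π : Fin K → Ω → Policy S A H}
  {f g : Fin K → Ω → QSeq S A H}

instance (k : Fin K) (h : Fin H) (ω : Ω) : IsProbabilityMeasure (episodeLaw G br π g k h ω) := by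
  unfold episodeLaw; infer_instance

lemma IsRun.mem_prodClass (hrun : IsRun G F P br β μ Z π f g) (k : Fin K) (ω : Ω) :
    π k ω ∈ prodClass P ∧ f k ω ∈ prodClass F ∧ g k ω ∈ prodClass F :=
  ⟨(hrun.optimistic_mem k ω).1, (hrun.optimistic_mem k ω).2.1, (hrun.pessimistic_mem k ω).2.1⟩

lemma IsRun.isCondLaw_nextState [IsProbabilityMeasure μ]
    (hrun : IsRun G F P br β μ Z π f g) (k : Fin K) (h : Fin H)
    (hn : (h : ℕ) + 1 < H) :
    IsCondLaw (afterActions Z k h) μ (fun ω => (Z k ⟨h + 1, hn⟩ ω).1)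
      (fun ω => G.trans h (Z k h ω)) :=
  isCondLaw_of_condExp (afterActions_le hrun.meas k h) (measurable_fst.comp (hrun.meas _ _))
    ((G.trans h).measurable.comp (measurable_afterActions k h)) (fun _ => inferInstance)
    (hrun.transition k h hn)

lemma targetNoise_of_lt (q : Policy S A H × QSeq S A H) {h : Fin H} (hn : (h : ℕ) + 1 < H)
    (ζ : Fin H → S × A × A) : targetNoise G P q h ζ =
      ∫ x', minValue P q.2 q.1 (h + 1) x' ∂(G.trans h (ζ h)) -
        minValue P q.2 q.1 (h + 1) (ζ ⟨h + 1, hn⟩).1 := by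
  unfold targetNoise bellman
  rw [dif_pos hn]
  ring

lemma targetNoise_of_not_lt (q : Policy S A H × QSeq S A H) {h : Fin H}
    (hn : ¬ (h : ℕ) + 1 < H) (ζ : Fin H → S × A × A) : targetNoise G P q h ζ = 0 := by
  unfold targetNoise bellman minValue
  simp [hn]

lemma abs_bellman_le (hF : IsBoundedClass F) (hcomp : StrongCompleteness G F P)
    {q : Policy S A H × QSeq S A H} (hq1 : q.1 ∈ prodClass P) (hq2 : q.2 ∈ prodClass F)
    (h : Fin H) (z : S × A × A) : |bellman G P q.1 q.2 h z| ≤ 1 :=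
  (hF h _ (hcomp _ hq1 _ hq2 h)).2 z

lemma measurable_bellman (hF : IsBoundedClass F) (hcomp : StrongCompleteness G F P)
    {q : Policy S A H × QSeq S A H} (hq1 : q.1 ∈ prodClass P) (hq2 : q.2 ∈ prodClass F)
    (h : Fin H) : Measurable (bellman G P q.1 q.2 h) :=
  (hF h _ (hcomp _ hq1 _ hq2 h)).1

lemma measurable_bellmanResidual (hF : IsBoundedClass F) (hcomp : StrongCompleteness G F P)
    {q : Policy S A H × QSeq S A H} (hq1 : q.1 ∈ prodClass P) (hq2 : q.2 ∈ prodClass F)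
    (h : Fin H) : Measurable (bellmanResidual G P q h) :=
  (hF h _ (hq2 h)).1.sub (measurable_bellman hF hcomp hq1 hq2 h)

lemma abs_bellmanResidual_le (hF : IsBoundedClass F) (hcomp : StrongCompleteness G F P)
    {q : Policy S A H × QSeq S A H} (hq1 : q.1 ∈ prodClass P) (hq2 : q.2 ∈ prodClass F)
    (h : Fin H) (z : S × A × A) : |bellmanResidual G P q h z| ≤ 2 := by
  have h1 := abs_le.1 ((hF h _ (hq2 h)).2 z)
  have h2 := abs_le.1 (abs_bellman_le hF hcomp hq1 hq2 h z)
  unfold bellmanResidual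
  rw [abs_le]
  constructor <;> linarith [h1.1, h1.2, h2.1, h2.2]

variable [Finite A] [MeasurableSingletonClass A]

lemma measurable_targetNoise (hF : IsBoundedClass F) (hbr : IsBestResponseMap F P br)
    (hcomp : StrongCompleteness G F P)
    {q : Policy S A H × QSeq S A H} (hq1 : q.1 ∈ prodClass P) (hq2 : q.2 ∈ prodClass F)
    (h : Fin H) : Measurable (targetNoise G P q h) := by
  unfold targetNoise
  refine (((measurable_bellman hF hcomp hq1 hq2 h).comp (measurable_pi_apply h)).sub
    ((G.reward_meas h).comp (measurable_pi_apply h))).sub ?_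
  split_ifs with hn
  · exact (measurable_minValue hF hbr hq2 hq1 _).comp
      (measurable_fst.comp (measurable_pi_apply _))
  · exact measurable_const

lemma IsRun.measurable_actionLaw (hrun : IsRun G F P br β μ Z π f g) (k : Fin K) (h : Fin H) :
    Measurable[(pastEpisodes Z k).prod inferInstance] fun q : Ω × S =>
      ((π k q.1 h).1 ×ₖ (bestResponse br (g k q.1) (π k q.1) h).1) q.2 :=
  @MarkovGame.measurable_actionLaw S A _ _ _ _ H Ω (pastEpisodes Z k) (π k)
    (fun ω => bestResponse br (g k ω) (π k ω)) (hrun.meas_π k) (hrun.meas_ν k) h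

lemma IsRun.measurable_episodeLaw (hrun : IsRun G F P br β μ Z π f g) (k : Fin K) (h : Fin H) :
    Measurable[pastEpisodes Z k] (episodeLaw G br π g k h) :=
  @measurable_occupancy S A _ _ _ _ H G Ω (pastEpisodes Z k) (π k)
    (fun ω => bestResponse br (g k ω) (π k ω)) (hrun.meas_π k) (hrun.meas_ν k) _ _ h

lemma IsRun.measurable_residualGap (hrun : IsRun G F P br β μ Z π f g) (k : Fin K) (h : Fin H) :
    Measurable[(pastEpisodes Z k).prod inferInstance]
      fun r : Ω × (S × A × A) => residualGap G br π f g k h r.1 r.2 :=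
  (@measurable_policyResidual_joint S A _ _ _ _ H G Ω (pastEpisodes Z k) (π k)
    (fun ω => bestResponse br (g k ω) (π k ω)) (f k) (hrun.meas_f k) (hrun.meas_π k)
    (hrun.meas_ν k) h).sub
  (@measurable_policyResidual_joint S A _ _ _ _ H G Ω (pastEpisodes Z k) (π k)
    (fun ω => bestResponse br (g k ω) (π k ω)) (g k) (hrun.meas_g k) (hrun.meas_π k)
    (hrun.meas_ν k) h)

lemma IsRun.abs_residualGap_le (hrun : IsRun G F P br β μ Z π f g) (hF : IsBoundedClass F)
    (k : Fin K) (h : Fin H) (ω : Ω) (z : S × A × A) : |residualGap G br π f g k h ω z| ≤ 6 := by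
  obtain ⟨-, hf, hg⟩ := hrun.mem_prodClass k ω
  have h1 := abs_le.1 (abs_policyResidual_le (G := G) (fun h => (hF h _ (hf h)).2) (π k ω)
    (bestResponse br (g k ω) (π k ω)) h z)
  have h2 := abs_le.1 (abs_policyResidual_le (G := G) (fun h => (hF h _ (hg h)).2) (π k ω)
    (bestResponse br (g k ω) (π k ω)) h z)
  unfold residualGap
  rw [abs_le]
  constructor <;> linarith [h1.1, h1.2, h2.1, h2.2]

variable [IsProbabilityMeasure μ]

lemma IsRun.isCondLaw_actions (hrun : IsRun G F P br β μ Z π f g) (k : Fin K) (h : Fin H) :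
    IsCondLaw (beforeActions Z k h) μ (fun ω => (Z k h ω).2) (fun ω =>
      ((π k ω h).1 ×ₖ (bestResponse br (g k ω) (π k ω) h).1) (Z k h ω).1) := by
  refine isCondLaw_of_condExp_singleton (beforeActions_le hrun.meas k h)
    (measurable_snd.comp (hrun.meas _ _)) ?_ (fun _ => inferInstance) ?_
  · have hmap : Measurable[beforeActions Z k h, (pastEpisodes Z k).prod inferInstance]
        (fun ω => (ω, (Z k h ω).1)) :=
      (measurable_id'' (pastEpisodes_le_beforeActions k h)).prodMk (measurable_beforeActions k h)
    have hcomp := (hrun.measurable_actionLaw k h).comp hmap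
    exact hcomp
  · rintro ⟨a, b⟩
    refine (hrun.actions k h a b).trans (Filter.Eventually.of_forall fun ω => ?_)
    simp only
    rw [Kernel.prod_apply, ← Set.singleton_prod_singleton, measureReal_prod_prod]

/-- Given the past episodes, `(x_h, a_h, b_h)` is distributed as if the chosen policies were
executed from the initial state. -/
lemma IsRun.isCondLaw_episode (hrun : IsRun G F P br β μ Z π f g) (k : Fin K) (h : Fin H) :
    IsCondLaw (pastEpisodes Z k) μ (Z k h) (episodeLaw G br π g k h) := by
  -- Actions are specified given the whole history of the episode, but their law depends only on the
  -- past episodes and the current state, so earlier steps can be integrated out.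
  have step : ∀ h : Fin H, IsCondLaw (pastEpisodes Z k) μ (fun ω => (Z k h ω).1)
      (fun ω => stateLaw G (π k ω) (bestResponse br (g k ω) (π k ω)) (Measure.dirac G.init) 0 h) →
      IsCondLaw (pastEpisodes Z k) μ (Z k h) (episodeLaw G br π g k h) := by
    intro h hs F' hF'
    have h1 := hs.lintegral_pair (pastEpisodes_le_beforeActions k h)
      (measurable_beforeActions k h) (hrun.measurable_actionLaw k h) (fun _ => inferInstance)
      (hrun.isCondLaw_actions k h) hF'
    refine h1.trans (lintegral_congr fun ω => ?_)
    have := isProbabilityMeasure_stateLaw G (π k ω) (bestResponse br (g k ω) (π k ω))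
      (Measure.dirac G.init) h h.2.le
    rw [episodeLaw, occupancy_zero, stateActionLaw, Measure.lintegral_compProd]
    exact hF'.comp (@measurable_prodMk_left _ _ (pastEpisodes Z k) _ ω)
  have main : ∀ n (hn : n < H), IsCondLaw (pastEpisodes Z k) μ (fun ω => (Z k ⟨n, hn⟩ ω).1)
      (fun ω => stateLaw G (π k ω) (bestResponse br (g k ω) (π k ω))
        (Measure.dirac G.init) 0 n) := by
    intro n
    induction n with
    | zero =>
      intro hn F' hF'
      refine lintegral_congr fun ω => ?_
      simp only
      rw [hrun.start k ω ⟨0, hn⟩ rfl, stateLaw, lintegral_dirac']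
      exact hF'.comp (@measurable_prodMk_left _ _ (pastEpisodes Z k) _ ω)
    | succ n ih =>
      intro hn F' hF'
      have hn' : n < H := by omega
      have hmap : Measurable[(pastEpisodes Z k).prod inferInstance,
          (pastEpisodes Z k).prod inferInstance]
          (fun q : Ω × (S × A × A) × S => (q.1, q.2.2)) :=
        (@measurable_fst _ _ (pastEpisodes Z k) _).prodMk
          (measurable_snd.comp (@measurable_snd _ _ (pastEpisodes Z k) _))
      have h1 := (step ⟨n, hn'⟩ (ih hn')).lintegral_pair
        (pastEpisodes_le_afterActions k ⟨n, hn'⟩) (measurable_afterActions k ⟨n, hn'⟩)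
        (κ₂ := fun q => G.trans ⟨n, hn'⟩ q.2)
        ((G.trans ⟨n, hn'⟩).measurable.comp (@measurable_snd _ _ (pastEpisodes Z k) _))
        (fun _ => inferInstance) (hrun.isCondLaw_nextState k ⟨n, hn'⟩ hn)
        (F := fun q => F' (q.1, q.2.2)) (hF'.comp hmap)
      refine h1.trans (lintegral_congr fun ω => ?_)
      simp only
      rw [stateLaw_succ G _ _ _ hn', Measure.lintegral_bind (Kernel.aemeasurable _)]
      · rfl
      · exact (hF'.comp (@measurable_prodMk_left _ _ (pastEpisodes Z k) _ ω)).aemeasurable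
  exact step h (main h h.2)

/-- Concentration of the noise terms for a fixed element of the classes. -/
lemma IsRun.measure_noise_le (hrun : IsRun G F P br β μ Z π f g) (hF : IsBoundedClass F)
    (hbr : IsBestResponseMap F P br) (hcomp : StrongCompleteness G F P)
    {q : Policy S A H × QSeq S A H} (hq1 : q.1 ∈ prodClass P) (hq2 : q.2 ∈ prodClass F)
    (k : Fin K) (h : Fin H) {δ : ℝ} (hδ : 0 < δ) :
    μ {ω | Real.log (1 / δ) < ∑ i with i < k,
      (-(1 / 4) * bellmanResidual G P q h (Z i h ω) * targetNoise G P q h (fun j => Z i j ω) -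
        bellmanResidual G P q h (Z i h ω) ^ 2 / 32)} ≤ ENNReal.ofReal δ := by
  set Y : Fin K → Ω → ℝ := fun i ω =>
    -(1 / 4) * bellmanResidual G P q h (Z i h ω) * targetNoise G P q h (fun j => Z i j ω) -
        bellmanResidual G P q h (Z i h ω) ^ 2 / 32 with hY
  have hmR := measurable_bellmanResidual hF hcomp hq1 hq2 h
  have hmT := measurable_targetNoise hF hbr hcomp hq1 hq2 h
  have hYm : ∀ i k, i < k → Measurable[pastEpisodes Z k] (Y i) := by
    intro i k hik
    have h1 : Measurable[pastEpisodes Z k] fun ω => bellmanResidual G P q h (Z i h ω) :=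
      hmR.comp (measurable_pastEpisodes hik h)
    have h2 : Measurable[pastEpisodes Z k] fun ω =>
        targetNoise G P q h (fun j => Z i j ω) :=
      hmT.comp (@measurable_pi_lambda _ _ _ (pastEpisodes Z k) _ _
        fun j => measurable_pastEpisodes hik j)
    exact ((h1.const_mul _).mul h2).sub ((h1.pow_const 2).div_const 32)
  have hexp := lintegral_exp_sum_le_one (μ := μ) (pastEpisodes Z) Y hYm (by
    intro i W hW
    by_cases hn : (h : ℕ) + 1 < H
    · have hm := measurable_minValue hF hbr hq2 hq1 (h + 1)
      have hb := abs_minValue_le hF hbr hq2 hq1 (h + 1)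
      have hi : Measurable fun z => ∫ x', minValue P q.2 q.1 (h + 1) x' ∂(G.trans h z) :=
        ((hm.comp measurable_snd).stronglyMeasurable.integral_kernel_prod_right').measurable
      have hZ : Measurable[(afterActions Z i h).prod inferInstance] fun r : Ω × S => Z i h r.1 :=
        (measurable_afterActions (Z := Z) i h).comp (@measurable_fst Ω S (afterActions Z i h) _)
      -- Hoeffding's lemma with range bound 1 and the random tilt R/4, which is known before the
      -- next state is drawn; the compensator (R/4)²/2 is R²/32. Conditioning on the actions is
      -- finer than on past episodes, so the weight `W` stays measurable.
      have := (hrun.isCondLaw_nextState i h hn).lintegral_mul_exp_le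
        (y := fun r => bellmanResidual G P q h (Z i h r.1) / 4 *
          (minValue P q.2 q.1 (h + 1) r.2 -
            ∫ x', minValue P q.2 q.1 (h + 1) x' ∂(G.trans h (Z i h r.1))) -
          (bellmanResidual G P q h (Z i h r.1) / 4) ^ 2 * 1 ^ 2 / 2)
        (((((hmR.comp hZ).div_const 4).mul
          ((hm.comp (@measurable_snd Ω S (afterActions Z i h) _)).sub (hi.comp hZ))).sub
            (((((hmR.comp hZ).div_const 4).pow_const 2).mul_const _).div_const 2)))
        (fun ω => lintegral_exp_centered_le_one (ρ := G.trans h (Z i h ω)) hm hb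
          (bellmanResidual G P q h (Z i h ω) / 4))
        (W := W) (hW.mono (pastEpisodes_le_afterActions i h) le_rfl)
      refine le_trans (le_of_eq (lintegral_congr fun ω => ?_)) this
      simp only [hY]
      rw [targetNoise_of_lt q hn]
      ring_nf
    -- At the last step the target has no next-state term, so the noise is zero and the exponent is
    -- nonpositive.
    · refine lintegral_mono fun ω => mul_le_of_le_one_right' ?_
      refine ENNReal.ofReal_le_one.2 (Real.exp_le_one_iff.2 ?_)
      simp only [hY]
      rw [targetNoise_of_not_lt q hn]
      have := sq_nonneg (bellmanResidual G P q h (Z i h ω))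
      linarith) k k.2.le
  refine measure_log_lt_le (S := fun ω => ∑ i with i < k, Y i ω) ?_ hexp hδ
  refine Finset.measurable_sum _ fun i hi => ?_
  exact (hYm i k (Finset.mem_filter.1 hi).2).mono (pastEpisodes_le hrun.meas k) le_rfl

/-- Concentration of the squared residuals of a fixed element of the classes. -/
lemma IsRun.measure_sq_le (hrun : IsRun G F P br β μ Z π f g) (hF : IsBoundedClass F)
    (hcomp : StrongCompleteness G F P)
    {q : Policy S A H × QSeq S A H} (hq1 : q.1 ∈ prodClass P) (hq2 : q.2 ∈ prodClass F)
    (k : Fin K) (h : Fin H) {δ : ℝ} (hδ : 0 < δ) :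
    μ {ω | Real.log (1 / δ) < ∑ i with i < k,
      ((∫ z, bellmanResidual G P q h z ^ 2 ∂(episodeLaw G br π g i h ω)) / 8 -
        bellmanResidual G P q h (Z i h ω) ^ 2 / 4)} ≤ ENNReal.ofReal δ := by
  set Y : Fin K → Ω → ℝ := fun i ω =>
    (∫ z, bellmanResidual G P q h z ^ 2 ∂(episodeLaw G br π g i h ω)) / 8 -
        bellmanResidual G P q h (Z i h ω) ^ 2 / 4 with hY
  have hmR := (measurable_bellmanResidual hF hcomp hq1 hq2 h).pow_const 2
  have hb : ∀ z, bellmanResidual G P q h z ^ 2 ≤ 4 := by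
    intro z
    have := abs_le.1 (abs_bellmanResidual_le hF hcomp hq1 hq2 h z)
    nlinarith [this.1, this.2]
  have hI : ∀ i, Measurable[pastEpisodes Z i] fun ω =>
      ∫ z, bellmanResidual G P q h z ^ 2 ∂(episodeLaw G br π g i h ω) := fun i =>
    @measurable_integral_of_measurable Ω (pastEpisodes Z i) _ _ _
      (hrun.measurable_episodeLaw i h) (fun _ => inferInstance)
      (fun r => bellmanResidual G P q h r.2 ^ 2)
      (hmR.comp (@measurable_snd _ _ (pastEpisodes Z i) _))
  have hYm : ∀ i k, i < k → Measurable[pastEpisodes Z k] (Y i) := by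
    intro i k hik
    exact (((hI i).mono (pastEpisodes_mono hik.le) le_rfl).div_const 8).sub
      ((hmR.comp (measurable_pastEpisodes hik h)).div_const 4)
  have hexp := lintegral_exp_sum_le_one (μ := μ) (pastEpisodes Z) Y hYm (fun i W hW =>
    (hrun.isCondLaw_episode i h).lintegral_mul_exp_le
      (y := fun r => (∫ z, bellmanResidual G P q h z ^ 2 ∂(episodeLaw G br π g i h r.1)) / 8 -
        bellmanResidual G P q h r.2 ^ 2 / 4)
      ((((hI i).comp (@measurable_fst _ _ (pastEpisodes Z i) _)).div_const 8).sub
        ((hmR.comp (@measurable_snd _ _ (pastEpisodes Z i) _)).div_const 4))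
      (fun ω => lintegral_exp_mean_sub_le_one hmR (fun _ => sq_nonneg _) hb) hW) k k.2.le
  refine measure_log_lt_le (S := fun ω => ∑ i with i < k, Y i ω) ?_ hexp hδ
  refine Finset.measurable_sum _ fun i hi => ?_
  exact (hYm i k (Finset.mem_filter.1 hi).2).mono (pastEpisodes_le hrun.meas k) le_rfl

/-- Concentration of the observed residuals around their conditional means. -/
lemma IsRun.measure_gap_le (hrun : IsRun G F P br β μ Z π f g) (hF : IsBoundedClass F)
    (h : Fin H) {δ : ℝ} (hδ : 0 < δ) (t : ℝ) :
    μ {ω | Real.log (1 / δ) < ∑ k, (t * (∫ z, residualGap G br π f g k h ω z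
        ∂(episodeLaw G br π g k h ω) - residualGap G br π f g k h ω (Z k h ω)) - 18 * t ^ 2)} ≤
      ENNReal.ofReal δ := by
  set Y : Fin K → Ω → ℝ := fun k ω =>
    t * (∫ z, residualGap G br π f g k h ω z ∂(episodeLaw G br π g k h ω) -
      residualGap G br π f g k h ω (Z k h ω)) - 18 * t ^ 2 with hY
  have hI : ∀ i, Measurable[pastEpisodes Z i] fun ω =>
      ∫ z, residualGap G br π f g i h ω z ∂(episodeLaw G br π g i h ω) := fun i =>
    @measurable_integral_of_measurable Ω (pastEpisodes Z i) _ _ _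
      (hrun.measurable_episodeLaw i h) (fun _ => inferInstance)
      (fun r => residualGap G br π f g i h r.1 r.2) (hrun.measurable_residualGap i h)
  have hΨ : ∀ i, Measurable[(pastEpisodes Z i).prod inferInstance]
      fun r : Ω × (S × A × A) => t * (∫ z, residualGap G br π f g i h r.1 z
        ∂(episodeLaw G br π g i h r.1) - residualGap G br π f g i h r.1 r.2) - 18 * t ^ 2 :=
    fun i => ((((hI i).comp (@measurable_fst _ _ (pastEpisodes Z i) _)).sub
      (hrun.measurable_residualGap i h)).const_mul t).sub_const _
  have hYm : ∀ i k, i < k → Measurable[pastEpisodes Z k] (Y i) := by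
    intro i k hik
    have hmap : Measurable[pastEpisodes Z k, (pastEpisodes Z i).prod inferInstance]
        fun ω => (ω, Z i h ω) :=
      (measurable_id'' (pastEpisodes_mono hik.le)).prodMk (measurable_pastEpisodes hik h)
    exact (hΨ i).comp hmap
  have hYm' : ∀ i, Measurable (Y i) := by
    intro i
    have hmap : Measurable[mΩ, (pastEpisodes Z i).prod inferInstance]
        fun ω => (ω, Z i h ω) :=
      (measurable_id'' (pastEpisodes_le hrun.meas i)).prodMk (hrun.meas i h)
    exact (hΨ i).comp hmap
  have hexp := lintegral_exp_sum_le_one (μ := μ) (pastEpisodes Z) Y hYm (by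
      intro i W hW
      -- The gap is determined by past episodes, so no net is needed here. It is bounded by 6,
      -- whence the compensator 6² t² / 2 = 18 t².
      have := (hrun.isCondLaw_episode i h).lintegral_mul_exp_le
        (y := fun r => -t * (residualGap G br π f g i h r.1 r.2 -
          ∫ z, residualGap G br π f g i h r.1 z ∂(episodeLaw G br π g i h r.1)) -
          (-t) ^ 2 * 6 ^ 2 / 2)
        ((((hrun.measurable_residualGap i h).sub
          ((hI i).comp (@measurable_fst _ _ (pastEpisodes Z i) _))).const_mul (-t)).sub_const _)
        (fun ω => lintegral_exp_centered_le_one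
          ((hrun.measurable_residualGap i h).comp
            (@measurable_prodMk_left _ _ (pastEpisodes Z i) _ ω))
          (hrun.abs_residualGap_le hF i h ω) _) hW
      refine le_trans (le_of_eq (lintegral_congr fun ω => ?_)) this
      simp only [hY]
      ring_nf) K le_rfl
  have huniv : (Finset.univ.filter fun i : Fin K => (i : ℕ) < K) = Finset.univ := by simp
  rw [huniv] at hexp
  exact measure_log_lt_le (S := fun ω => ∑ i, Y i ω)
    (Finset.measurable_sum _ fun i _ => hYm' i)
    hexp hδ

end Run

/-! ### Elementary inequalities -/

section Elementary

/-- Net errors of order 1/K, summed over the earlier episodes, stay bounded. -/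
lemma card_filter_lt_mul_le {K : ℕ} (hK : 0 < K) (k : Fin K) :
    ((Finset.univ.filter fun i : Fin K => i < k).card : ℝ) * (1 / K) ≤ 1 := by
  have h1 : ((Finset.univ.filter fun i : Fin K => i < k).card : ℝ) ≤ K := by
    have := Finset.card_le_univ (Finset.univ.filter fun i : Fin K => i < k)
    rw [Fintype.card_fin] at this
    exact_mod_cast this
  have hK' : (0 : ℝ) < K := by exact_mod_cast hK
  rw [mul_one_div, div_le_one hK']
  exact h1

lemma abs_sq_sub_sq_le {a a' c η : ℝ} (ha : |a| ≤ c) (ha' : |a'| ≤ c) (h : |a - a'| ≤ η) :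
    |a ^ 2 - a' ^ 2| ≤ 2 * c * η := by
  have : a ^ 2 - a' ^ 2 = (a + a') * (a - a') := by ring
  rw [this, abs_mul]
  exact mul_le_mul ((abs_add_le _ _).trans (by linarith)) h (abs_nonneg _)
    (by linarith [abs_nonneg a])

lemma abs_mul_sub_mul_le {a a' x x' c η θ : ℝ} (hx : |x| ≤ c) (ha' : |a'| ≤ c)
    (h : |a - a'| ≤ η) (hx' : |x - x'| ≤ θ) : |a * x - a' * x'| ≤ c * (η + θ) := by
  have : a * x - a' * x' = x * (a - a') + a' * (x - x') := by ring
  rw [this]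
  refine (abs_add_le _ _).trans ?_
  rw [abs_mul, abs_mul, mul_add]
  exact add_le_add (mul_le_mul hx h (abs_nonneg _) ((abs_nonneg _).trans hx))
    (mul_le_mul ha' hx' (abs_nonneg _) ((abs_nonneg _).trans ha'))

lemma sq_integral_le_integral_sq {E : Type*} [MeasurableSpace E] {ρ : Measure E}
    [IsProbabilityMeasure ρ] {u : E → ℝ} (hu : Measurable u) {c : ℝ} (hb : ∀ e, |u e| ≤ c) :
    (∫ e, u e ∂ρ) ^ 2 ≤ ∫ e, u e ^ 2 ∂ρ := by
  set I := ∫ e, u e ∂ρ with hI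
  have i1 : Integrable u ρ := integrable_of_abs_le hu hb
  have i2 : Integrable (fun e => u e ^ 2) ρ := integrable_of_abs_le (c := c ^ 2) (hu.pow_const 2)
    fun e => by
      rw [abs_of_nonneg (sq_nonneg _), ← sq_abs]
      exact pow_le_pow_left₀ (abs_nonneg _) (hb e) 2
  have h0 : 0 ≤ ∫ e, (u e ^ 2 - (2 * I) * u e + I ^ 2) ∂ρ :=
    integral_nonneg fun e => by
      have := sq_nonneg (u e - I)
      simp only [Pi.zero_apply]
      linarith
  have i3 : Integrable (fun e => u e ^ 2 - (2 * I) * u e) ρ := i2.sub (i1.const_mul _)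
  rw [integral_add i3 (integrable_const _), integral_sub i2 (i1.const_mul _),
    integral_const_mul, ← hI] at h0
  simp at h0
  linarith

end Elementary

/-! ### From a finite net to the whole classes -/

section Approximation

variable {S A : Type*} [MeasurableSpace S] [MeasurableSpace A] {H K : ℕ}
  {G : Game S A H} {F : Fin H → Set (S × A × A → ℝ)} {P : Fin H → Set (StepPolicy S A)}
  {br : Fin H → (S × A × A → ℝ) → StepPolicy S A → StepPolicy S A}

/-- `ε`-closeness of pairs of policies and functions, in the metrics of the covering numbers. -/
def IsClose (F : Fin H → Set (S × A × A → ℝ)) (ε : ℝ) (q q' : Policy S A H × QSeq S A H) :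
    Prop :=
  (∀ h z, |q.2 h z - q'.2 h z| ≤ ε) ∧
    ∀ h, ∀ u ∈ F h, ∀ x b, |evalQLeft u (q.1 h) x b - evalQLeft u (q'.1 h) x b| ≤ ε

lemma exists_net (ε : ℝ≥0) (hFc : coverF F ε ≠ ⊤) (hPc : coverP F P ε ≠ ⊤) :
    ∃ s : Finset (Policy S A H × QSeq S A H), (∀ q ∈ s, q.1 ∈ prodClass P ∧ q.2 ∈ prodClass F) ∧
      s.card ≤ (coverF F ε).toNat * (coverP F P ε).toNat ∧
      ∀ q : Policy S A H × QSeq S A H, q.1 ∈ prodClass P → q.2 ∈ prodClass F →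
        ∃ q' ∈ s, IsClose F ε q q' := by
  obtain ⟨sF, hsF, hcF, hF⟩ := exists_finset_cover _ _ _ hFc
  obtain ⟨sP, hsP, hcP, hP⟩ := exists_finset_cover _ _ _ hPc
  refine ⟨sP ×ˢ sF, fun q hq => ?_, ?_, fun q hq1 hq2 => ?_⟩
  · rw [Finset.mem_product] at hq
    exact ⟨hsP hq.1, hsF hq.2⟩
  · rw [Finset.card_product, mul_comm]
    exact Nat.mul_le_mul hcF hcP
  · obtain ⟨f', hf', hff'⟩ := hF _ hq2
    obtain ⟨π', hπ', hππ'⟩ := hP _ hq1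
    refine ⟨(π', f'), Finset.mem_product.2 ⟨hπ', hf'⟩, fun h z => ?_, fun h u hu x b => ?_⟩
    · exact abs_sub_le_of_edist_uniformFun (edist_pi_le_iff.1 hff' h) z
    · exact abs_sub_le_of_edist_uniformFun (edist_pi_le_iff.1 hππ' h) (⟨u, hu⟩, x, b)

variable [Finite A] [MeasurableSingletonClass A] {ε : ℝ} {q q' : Policy S A H × QSeq S A H}

lemma abs_minValue_sub_le_of_isClose (hbr : IsBestResponseMap F P br) (hε : 0 ≤ ε)
    (hq1 : q.1 ∈ prodClass P) (hq2 : q.2 ∈ prodClass F)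
    (hq1' : q'.1 ∈ prodClass P) (hq2' : q'.2 ∈ prodClass F) (hqq : IsClose F ε q q')
    (n : ℕ) (x : S) : |minValue P q.2 q.1 n x - minValue P q'.2 q'.1 n x| ≤ 2 * ε :=
  abs_minValue_sub_le hbr hq2 hq2' hq1 hq1' hε hqq.1 hqq.2 n x

lemma abs_integral_minValue_sub_le (hF : IsBoundedClass F) (hbr : IsBestResponseMap F P br)
    (hε : 0 ≤ ε) (hq1 : q.1 ∈ prodClass P) (hq2 : q.2 ∈ prodClass F)
    (hq1' : q'.1 ∈ prodClass P) (hq2' : q'.2 ∈ prodClass F) (hqq : IsClose F ε q q')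
    (n : ℕ) (ρ : Measure S) [IsProbabilityMeasure ρ] :
    |∫ x, minValue P q.2 q.1 n x ∂ρ - ∫ x, minValue P q'.2 q'.1 n x ∂ρ| ≤ 2 * ε :=
  abs_integral_sub_le_of_abs_le
    (integrable_of_abs_le (measurable_minValue hF hbr hq2 hq1 _) (abs_minValue_le hF hbr hq2 hq1 _))
    (integrable_of_abs_le (measurable_minValue hF hbr hq2' hq1' _)
      (abs_minValue_le hF hbr hq2' hq1' _))
    (abs_minValue_sub_le_of_isClose hbr hε hq1 hq2 hq1' hq2' hqq n)

lemma abs_bellmanResidual_sub_le (hF : IsBoundedClass F) (hbr : IsBestResponseMap F P br)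
    (hε : 0 ≤ ε) (hq1 : q.1 ∈ prodClass P) (hq2 : q.2 ∈ prodClass F)
    (hq1' : q'.1 ∈ prodClass P) (hq2' : q'.2 ∈ prodClass F) (hqq : IsClose F ε q q')
    (h : Fin H) (z : S × A × A) :
    |bellmanResidual G P q h z - bellmanResidual G P q' h z| ≤ 3 * ε := by
  have h1 := abs_le.1 (abs_integral_minValue_sub_le hF hbr hε hq1 hq2 hq1' hq2' hqq (h + 1)
    (G.trans h z))
  have h2 := abs_le.1 (hqq.1 h z)
  unfold bellmanResidual bellman
  rw [abs_le]
  constructor <;> linarith [h1.1, h1.2, h2.1, h2.2]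

lemma abs_targetNoise_sub_le (hF : IsBoundedClass F) (hbr : IsBestResponseMap F P br)
    (hε : 0 ≤ ε) (hq1 : q.1 ∈ prodClass P) (hq2 : q.2 ∈ prodClass F)
    (hq1' : q'.1 ∈ prodClass P) (hq2' : q'.2 ∈ prodClass F) (hqq : IsClose F ε q q')
    (h : Fin H) (ζ : Fin H → S × A × A) :
    |targetNoise G P q h ζ - targetNoise G P q' h ζ| ≤ 4 * ε := by
  by_cases hn : (h : ℕ) + 1 < H
  · rw [targetNoise_of_lt q hn, targetNoise_of_lt q' hn]
    have h1 := abs_le.1 (abs_integral_minValue_sub_le hF hbr hε hq1 hq2 hq1' hq2' hqq (h + 1)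
      (G.trans h (ζ h)))
    have h2 := abs_le.1 (abs_minValue_sub_le_of_isClose hbr hε hq1 hq2 hq1' hq2' hqq (h + 1)
      (ζ ⟨h + 1, hn⟩).1)
    rw [abs_le]
    constructor <;> linarith [h1.1, h1.2, h2.1, h2.2]
  · rw [targetNoise_of_not_lt q hn, targetNoise_of_not_lt q' hn]
    simpa using hε

lemma abs_targetNoise_le (hF : IsBoundedClass F) (hbr : IsBestResponseMap F P br)
    (hq1 : q.1 ∈ prodClass P) (hq2 : q.2 ∈ prodClass F) (h : Fin H) (ζ : Fin H → S × A × A) :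
    |targetNoise G P q h ζ| ≤ 2 := by
  by_cases hn : (h : ℕ) + 1 < H
  · rw [targetNoise_of_lt q hn]
    have h1 := abs_le.1 (abs_integral_le_of_abs_le (ρ := G.trans h (ζ h))
      (abs_minValue_le hF hbr hq2 hq1 (h + 1)))
    have h2 := abs_le.1 (abs_minValue_le hF hbr hq2 hq1 (h + 1) (ζ ⟨h + 1, hn⟩).1)
    rw [abs_le]
    constructor <;> linarith [h1.1, h1.2, h2.1, h2.2]
  · rw [targetNoise_of_not_lt q hn]
    simp

/-- From a net to the whole classes: excess losses dominate squared residuals. -/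
lemma half_sum_sq_le_excess (hF : IsBoundedClass F) (hbr : IsBestResponseMap F P br)
    (hcomp : StrongCompleteness G F P) (hq1 : q.1 ∈ prodClass P) (hq2 : q.2 ∈ prodClass F)
    (hq1' : q'.1 ∈ prodClass P) (hq2' : q'.2 ∈ prodClass F) (hqq : IsClose F (1 / K) q q')
    (ζ : Fin K → Fin H → S × A × A) (k : Fin K) (h : Fin H) {L : ℝ} (hL : 1 / 2 ≤ L)
    (hnoise : ∑ i with i < k, (-(1 / 4) * bellmanResidual G P q' h (ζ i h) *
      targetNoise G P q' h (ζ i) - bellmanResidual G P q' h (ζ i h) ^ 2 / 32) ≤ 3 * L) :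
    1 / 2 * ∑ i with i < k, bellmanResidual G P q h (ζ i h) ^ 2 - 100 * L ≤
      ∑ i with i < k, (bellmanResidual G P q h (ζ i h) ^ 2 +
        2 * (bellmanResidual G P q h (ζ i h) * targetNoise G P q h (ζ i))) := by
  have hK : 0 < K := k.pos
  have hε : (0 : ℝ) ≤ 1 / K := by positivity
  -- With 3/K for the residuals, 4/K for the noise and all of them at most 2, half the squares
  -- change by 6/K and twice the products by 28/K, in total 34/K. After summation 24 L + 34 is below
  -- 100 L because `L ≥ 1/2`.
  have hterm : ∀ i, -(8 * (-(1 / 4) * bellmanResidual G P q' h (ζ i h) *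
      targetNoise G P q' h (ζ i) - bellmanResidual G P q' h (ζ i h) ^ 2 / 32)) - 34 * (1 / K) ≤
      bellmanResidual G P q h (ζ i h) ^ 2 +
        2 * (bellmanResidual G P q h (ζ i h) * targetNoise G P q h (ζ i)) -
        1 / 2 * bellmanResidual G P q h (ζ i h) ^ 2 := by
    intro i
    have a1 := abs_bellmanResidual_le hF hcomp hq1 hq2 h (ζ i h)
    have a2 := abs_bellmanResidual_le hF hcomp hq1' hq2' h (ζ i h)
    have a3 := abs_bellmanResidual_sub_le (G := G) hF hbr hε hq1 hq2 hq1' hq2' hqq h (ζ i h)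
    have a4 := abs_targetNoise_le (G := G) hF hbr hq1 hq2 h (ζ i)
    have a5 := abs_targetNoise_sub_le (G := G) hF hbr hε hq1 hq2 hq1' hq2' hqq h (ζ i)
    have b1 := (abs_le.1 (abs_sq_sub_sq_le a1 a2 a3)).1
    have b2 := (abs_le.1 (abs_mul_sub_mul_le a4 a2 a3 a5)).1
    have b3 := sq_nonneg (bellmanResidual G P q' h (ζ i h))
    linarith
  have hsum := Finset.sum_le_sum fun i (_ : i ∈ Finset.univ.filter fun i : Fin K => i < k) =>
    hterm i
  rw [Finset.sum_sub_distrib, Finset.sum_sub_distrib, Finset.sum_neg_distrib, ← Finset.mul_sum,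
    ← Finset.mul_sum, Finset.sum_const, nsmul_eq_mul] at hsum
  have := card_filter_lt_mul_le hK k
  rw [Finset.mul_sum]
  linarith

/-- From a net to the whole classes: observed squared residuals dominate expected ones. -/
lemma sum_sq_integral_le (hF : IsBoundedClass F) (hbr : IsBestResponseMap F P br)
    (hcomp : StrongCompleteness G F P) (hq1 : q.1 ∈ prodClass P) (hq2 : q.2 ∈ prodClass F)
    (hq1' : q'.1 ∈ prodClass P) (hq2' : q'.2 ∈ prodClass F) (hqq : IsClose F (1 / K) q q')
    (ζ : Fin K → Fin H → S × A × A) (ρ : Fin K → Measure (S × A × A))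
    (hρ : ∀ i, IsProbabilityMeasure (ρ i)) (k : Fin K) (h : Fin H) {L : ℝ} (hL : 1 / 2 ≤ L)
    (hsq : ∑ i with i < k, ((∫ z, bellmanResidual G P q' h z ^ 2 ∂(ρ i)) / 8 -
      bellmanResidual G P q' h (ζ i h) ^ 2 / 4) ≤ 3 * L) :
    ∑ i with i < k, (∫ z, bellmanResidual G P q h z ∂(ρ i)) ^ 2 ≤
      2 * ∑ i with i < k, bellmanResidual G P q h (ζ i h) ^ 2 + 100 * L := by
  have hK : 0 < K := k.pos
  have hε : (0 : ℝ) ≤ 1 / K := by positivity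
  have hm := measurable_bellmanResidual hF hcomp hq1 hq2 h
  have hm' := measurable_bellmanResidual hF hcomp hq1' hq2' h
  have a1 := abs_bellmanResidual_le hF hcomp hq1 hq2 h
  have a2 := abs_bellmanResidual_le hF hcomp hq1' hq2' h
  have a3 := abs_bellmanResidual_sub_le (G := G) hF hbr hε hq1 hq2 hq1' hq2' hqq h
  have hb4 : ∀ {r : ℝ}, |r| ≤ 2 → |r ^ 2| ≤ 4 := fun {r} hr => by
    rw [abs_pow]
    nlinarith [abs_nonneg r]
  -- The expected square changes by 12/K and twice the observed square by 24/K, in total 36/K.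
  have hterm : ∀ i, (∫ z, bellmanResidual G P q h z ∂(ρ i)) ^ 2 ≤
      2 * bellmanResidual G P q h (ζ i h) ^ 2 +
      (8 * ((∫ z, bellmanResidual G P q' h z ^ 2 ∂(ρ i)) / 8 -
      bellmanResidual G P q' h (ζ i h) ^ 2 / 4) + 36 * (1 / K)) := by
    intro i
    have := hρ i
    have b0 := sq_integral_le_integral_sq (ρ := ρ i) hm a1
    have b1 := (abs_le.1 (abs_sq_sub_sq_le (a1 (ζ i h)) (a2 (ζ i h)) (a3 (ζ i h)))).1
    have b2 := (abs_le.1 (abs_integral_sub_le_of_abs_le (ρ := ρ i)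
      (integrable_of_abs_le (hm.pow_const 2) fun z => hb4 (a1 z))
      (integrable_of_abs_le (hm'.pow_const 2) fun z => hb4 (a2 z))
      fun z => abs_sq_sub_sq_le (a1 z) (a2 z) (a3 z))).2
    linarith
  have hsum := Finset.sum_le_sum fun i (_ : i ∈ Finset.univ.filter fun i : Fin K => i < k) =>
    hterm i
  rw [Finset.sum_add_distrib, Finset.sum_add_distrib, ← Finset.mul_sum,
    ← Finset.mul_sum, Finset.sum_const, nsmul_eq_mul] at hsum
  have := card_filter_lt_mul_le hK k
  linarith

end Approximation

/-! ### What membership in the constraint set means -/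

section ConstraintSet

variable {S A : Type*} [MeasurableSpace S] [MeasurableSpace A] {H K : ℕ}
  {G : Game S A H} {F : Fin H → Set (S × A × A → ℝ)} {P : Fin H → Set (StepPolicy S A)}
  {br : Fin H → (S × A × A → ℝ) → StepPolicy S A → StepPolicy S A}
  {q : Policy S A H × QSeq S A H}

/-- The target is T f minus the noise, so each loss is the square of (u - T f) + noise, and the
squared noise cancels. -/
lemma sqLoss_sub_sqLoss_bellman (hbr : IsBestResponseMap F P br)
    (hq1 : q.1 ∈ prodClass P) (hq2 : q.2 ∈ prodClass F)
    (ζ : Fin K → Fin H → S × A × A) (k : Fin K) (h : Fin H) (u : S × A × A → ℝ) :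
    sqLoss G br ζ k h u q.1 q.2 - sqLoss G br ζ k h (bellman G P q.1 q.2 h) q.1 q.2 =
      ∑ i with i < k, ((u (ζ i h) - bellman G P q.1 q.2 h (ζ i h)) ^ 2 +
        2 * ((u (ζ i h) - bellman G P q.1 q.2 h (ζ i h)) * targetNoise G P q h (ζ i))) := by
  unfold sqLoss
  rw [← Finset.sum_sub_distrib]
  refine Finset.sum_congr rfl fun i _ => ?_
  unfold targetNoise
  simp_rw [minValue_eq_stageValue hbr hq2 hq1]
  ring

lemma targetNoise_congr {f f' : QSeq S A H} {π : Policy S A H} {h : Fin H}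
    (hff : ∀ h' : Fin H, (h' : ℕ) = h + 1 → f h' = f' h') (ζ : Fin H → S × A × A) :
    targetNoise G P (π, f) h ζ = targetNoise G P (π, f') h ζ := by
  unfold targetNoise
  simp only
  rw [bellman_congr hff]
  congr 1
  split_ifs with hn
  · unfold minValue
    rw [dif_pos hn, dif_pos hn, hff ⟨h + 1, hn⟩ rfl]
  · rfl

lemma sqLoss_nonneg (ζ : Fin K → Fin H → S × A × A) (k : Fin K) (h : Fin H) (u : S × A × A → ℝ)
    (π : Policy S A H) (f : QSeq S A H) : 0 ≤ sqLoss G br ζ k h u π f :=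
  Finset.sum_nonneg fun _ _ => sq_nonneg _

/-- By completeness T f competes in the infimum, so the excess loss of a member over T f is at most
`β`. -/
lemma sum_sq_le_of_mem_constraintSet (hbr : IsBestResponseMap F P br)
    (hcomp : StrongCompleteness G F P) {β L : ℝ} (ζ : Fin K → Fin H → S × A × A) (k : Fin K)
    (hexc : ∀ q : Policy S A H × QSeq S A H, q.1 ∈ prodClass P → q.2 ∈ prodClass F → ∀ h,
      1 / 2 * ∑ i with i < k, bellmanResidual G P q h (ζ i h) ^ 2 - 100 * L ≤
      ∑ i with i < k, (bellmanResidual G P q h (ζ i h) ^ 2 +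
        2 * (bellmanResidual G P q h (ζ i h) * targetNoise G P q h (ζ i))))
    (hq : q ∈ constraintSet G F P br β ζ k) (h : Fin H) :
    ∑ i with i < k, bellmanResidual G P q h (ζ i h) ^ 2 ≤ 2 * β + 200 * L := by
  obtain ⟨hq1, hq2, hq3⟩ := hq
  have h1 := hexc q hq1 hq2 h
  have h2 := sqLoss_sub_sqLoss_bellman (G := G) hbr hq1 hq2 ζ k h (q.2 h)
  have h3 : (⨅ u : F h, sqLoss G br ζ k h u.1 q.1 q.2) ≤
      sqLoss G br ζ k h (bellman G P q.1 q.2 h) q.1 q.2 := by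
    refine ciInf_le (f := fun u : F h => sqLoss G br ζ k h u.1 q.1 q.2) ⟨0, ?_⟩
      ⟨_, hcomp _ hq1 _ hq2 h⟩
    rintro _ ⟨u, rfl⟩
    exact sqLoss_nonneg _ _ _ _ _ _
  have h4 := hq3 h
  unfold bellmanResidual at h1 ⊢
  linarith

/-- At a fixed point Q_h is its own regression mean, so no competitor can beat it by more than `100
* L`. -/
lemma fixedPoint_mem_constraintSet (hbr : IsBestResponseMap F P br) {β L : ℝ} (hβ : 100 * L ≤ β)
    (ζ : Fin K → Fin H → S × A × A) (k : Fin K)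
    (hexc : ∀ q : Policy S A H × QSeq S A H, q.1 ∈ prodClass P → q.2 ∈ prodClass F → ∀ h,
      1 / 2 * ∑ i with i < k, bellmanResidual G P q h (ζ i h) ^ 2 - 100 * L ≤
      ∑ i with i < k, (bellmanResidual G P q h (ζ i h) ^ 2 +
        2 * (bellmanResidual G P q h (ζ i h) * targetNoise G P q h (ζ i))))
    {π : Policy S A H} (hπ : π ∈ prodClass P) {Q : QSeq S A H} (hQ : Q ∈ prodClass F)
    (hfix : ∀ h, bellman G P π Q h = Q h) : (π, Q) ∈ constraintSet G F P br β ζ k := by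
  refine ⟨hπ, hQ, fun h => ?_⟩
  have : Nonempty (F h) := ⟨⟨_, hQ h⟩⟩
  rw [← sub_le_iff_le_add]
  refine le_ciInf fun u => ?_
  -- The uniform bound covers residuals f_h - T f_{h+1} with f in F. A competitor `u` is brought
  -- into this form by putting it at entry `h` of `Q`, which leaves the operator at `h` unchanged.
  have hup : Function.update Q h u.1 ∈ prodClass F := by
    intro h'
    by_cases hh : h' = h
    · subst hh
      rw [Function.update_self]
      exact u.2
    · rw [Function.update_of_ne hh]
      exact hQ h'
  have hne : ∀ h' : Fin H, (h' : ℕ) = h + 1 → Function.update Q h u.1 h' = Q h' := by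
    intro h' hh'
    refine Function.update_of_ne ?_ _ _
    rintro rfl
    omega
  have h1 := hexc (π, Function.update Q h u.1) hπ hup h
  have h2 := sqLoss_sub_sqLoss_bellman (G := G) (q := (π, Q)) hbr hπ hQ ζ k h u.1
  have h3 : 0 ≤ ∑ i with i < k,
      bellmanResidual G P (π, Function.update Q h u.1) h (ζ i h) ^ 2 :=
    Finset.sum_nonneg fun _ _ => sq_nonneg _
  simp only [bellmanResidual, targetNoise_congr hne, bellman_congr hne, Function.update_self]
    at h1 h2 h3
  rw [hfix] at h1 h2 h3
  simp only
  linarith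

end ConstraintSet

/-! ### Decomposition of the regret -/

section Regret

variable {S A : Type*} [MeasurableSpace S] [MeasurableSpace A] [Finite A]
  [MeasurableSingletonClass A] {H K : ℕ}
  {G : Game S A H} {F : Fin H → Set (S × A × A → ℝ)} {P : Fin H → Set (StepPolicy S A)}
  {br : Fin H → (S × A × A → ℝ) → StepPolicy S A → StepPolicy S A} {β : ℝ}
  {Ω : Type*} [mΩ : MeasurableSpace Ω] {μ : Measure Ω}
  {Z : Fin K → Fin H → Ω → S × A × A} {π : Fin K → Ω → Policy S A H}
  {f g : Fin K → Ω → QSeq S A H}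

/-- Optimism and pessimism: the loss of an episode is at most the total expected gap. -/
lemma IsRun.gameValue_sub_worstValue_le (hrun : IsRun G F P br β μ Z π f g)
    (hF : IsBoundedClass F) (hbr : IsBestResponseMap F P br) (hcomp : StrongCompleteness G F P)
    (k : Fin K) (ω : Ω)
    (hmem : ∀ π' ∈ prodClass P, ∀ Q ∈ prodClass F, (∀ h, bellman G P π' Q h = Q h) →
      (π', Q) ∈ constraintSet G F P br β (fun i h => Z i h ω) k) :
    gameValue G P - worstValue G P (π k ω) ≤
      ∑ h, ∫ z, residualGap G br π f g k h ω z ∂(episodeLaw G br π g k h ω) := by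
  obtain ⟨hπ, hf, hg⟩ := hrun.mem_prodClass k ω
  have hne : (prodClass F).Nonempty := ⟨_, hf⟩
  have h1 : gameValue G P ≤ initValue G br (π k ω, f k ω) := by
    have : Nonempty (prodClass P) := ⟨⟨_, hπ⟩⟩
    refine ciSup_le fun π' => ?_
    obtain ⟨Q, hQ, hfix⟩ := exists_bellman_fixedPoint hcomp hne π'.2
    rw [worstValue_eq_initValue hF hbr π'.2 hQ hfix]
    exact hrun.optimistic k ω (hmem _ π'.2 Q hQ hfix)
  have h2 : initValue G br (π k ω, g k ω) ≤ worstValue G P (π k ω) := by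
    obtain ⟨Q, hQ, hfix⟩ := exists_bellman_fixedPoint hcomp hne hπ
    rw [worstValue_eq_initValue hF hbr hπ hQ hfix]
    exact hrun.pessimistic k ω (hmem _ hπ Q hQ hfix)
  set ν := bestResponse br (g k ω) (π k ω) with hν
  have hνP : ν ∈ prodClass P := bestResponse_mem hbr hg hπ
  -- Exchanging the best response to f^k for the executed `ν` raises the optimistic estimate, so
  -- that both estimates telescope along the same trajectory law.
  have h3 := minValue_le_stageValue hbr hf hπ hνP 0 G.init
  rw [minValue_eq_stageValue hbr hf hπ] at h3
  have hmf : ∀ h, Measurable (f k ω h) := fun h => (hF h _ (hf h)).1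
  have hmg : ∀ h, Measurable (g k ω h) := fun h => (hF h _ (hg h)).1
  have hbf : ∀ h z, |f k ω h z| ≤ 1 := fun h => (hF h _ (hf h)).2
  have hbg : ∀ h z, |g k ω h z| ≤ 1 := fun h => (hF h _ (hg h)).2
  have h4 := sum_integral_policyResidual (G := G) hmf hbf (π k ω) ν
  have h5 := sum_integral_policyResidual (G := G) hmg hbg (π k ω) ν
  have h6 : ∑ h, ∫ z, residualGap G br π f g k h ω z ∂(episodeLaw G br π g k h ω) =
      stageValue (f k ω) (π k ω) ν 0 G.init - stageValue (g k ω) (π k ω) ν 0 G.init := by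
    have : ∀ h, ∫ z, residualGap G br π f g k h ω z ∂(episodeLaw G br π g k h ω) =
        ∫ z, policyResidual G (π k ω) ν (f k ω) h z
          ∂(occupancy G (π k ω) ν (Measure.dirac G.init) 0 h) -
        ∫ z, policyResidual G (π k ω) ν (g k ω) h z
          ∂(occupancy G (π k ω) ν (Measure.dirac G.init) 0 h) := fun h =>
      integral_sub
        (integrable_of_abs_le (measurable_policyResidual hmf _ _ h) (abs_policyResidual_le hbf _ _ h))
        (integrable_of_abs_le (measurable_policyResidual hmg _ _ h) (abs_policyResidual_le hbg _ _ h))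
    simp_rw [this]
    rw [Finset.sum_sub_distrib, h4, h5]
    ring
  rw [h6]
  unfold initValue at h1 h2
  simp only at h1 h2
  rw [← hν] at h2
  linarith

/-- The executed second player responds optimally to g^k, so its on-policy residual equals its
Bellman residual; that of f^k is only bounded above by its own. -/
lemma IsRun.residualGap_le (hrun : IsRun G F P br β μ Z π f g)
    (hF : IsBoundedClass F) (hbr : IsBestResponseMap F P br)
    (k : Fin K) (h : Fin H) (ω : Ω) (z : S × A × A) :
    residualGap G br π f g k h ω z ≤
      bellmanResidual G P (π k ω, f k ω) h z - bellmanResidual G P (π k ω, g k ω) h z := by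
  obtain ⟨hπ, hf, hg⟩ := hrun.mem_prodClass k ω
  unfold residualGap bellmanResidual
  rw [policyResidual_bestResponse hbr hg hπ]
  have := policyResidual_le (G := G) hF hbr hf hπ (bestResponse_mem hbr hg hπ) h z
  simp only
  linarith

/-- The total gap at one step, on the event that the concentration bounds hold. -/
lemma IsRun.sum_integral_gap_le (hrun : IsRun G F P br β μ Z π f g)
    (hF : IsBoundedClass F) (hbr : IsBestResponseMap F P br) (hcomp : StrongCompleteness G F P)
    (hdim : dimME G F P br √(1 / K) ≠ ⊤) (h : Fin H) (ω : Ω) {B R : ℝ} (hB : 0 ≤ B) (hR : 0 ≤ R)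
    (hsq : ∀ k, ∀ q ∈ constraintSet G F P br β (fun i h => Z i h ω) k,
      ∑ i with i < k, bellmanResidual G P q h (Z i h ω) ^ 2 ≤ B)
    (hsqI : ∀ k, ∀ q ∈ constraintSet G F P br β (fun i h => Z i h ω) k,
      ∑ i with i < k, (∫ z, bellmanResidual G P q h z ∂(episodeLaw G br π g i h ω)) ^ 2 ≤ B)
    (hgap : ∑ k, ∫ z, residualGap G br π f g k h ω z ∂(episodeLaw G br π g k h ω) ≤
      ∑ k, residualGap G br π f g k h ω (Z k h ω) + R) :
    ∑ k, ∫ z, residualGap G br π f g k h ω z ∂(episodeLaw G br π g k h ω) ≤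
      2 * (√(K * max 1 ((dimME G F P br √(1 / K)).toNat : ℝ)) * (3 + 2 * √B)) + R := by
  have hd : min (dimDE (residuals G F P h) (diracFamily S A) √(1 / K))
      (dimDE (residuals G F P h) (executedFamily G F P br h) √(1 / K)) ≤
      ((dimME G F P br √(1 / K)).toNat : ℕ∞) := by
    rw [ENat.natCast_toNat hdim]
    exact le_iSup (fun h => min (dimDE (residuals G F P h) (diracFamily S A) √(1 / K))
      (dimDE (residuals G F P h) (executedFamily G F P br h) √(1 / K))) h
  set d := (dimME G F P br √(1 / K)).toNat
  have hmemf := fun k => hrun.optimistic_mem k ω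
  have hmemg := fun k => hrun.pessimistic_mem k ω
  have hmeas : ∀ k, ∀ q ∈ constraintSet G F P br β (fun i h => Z i h ω) k,
      Measurable (bellmanResidual G P q h) := fun k q hq =>
    measurable_bellmanResidual hF hcomp hq.1 hq.2.1 h
  have habs : ∀ k, ∀ q ∈ constraintSet G F P br β (fun i h => Z i h ω) k, ∀ z,
      |bellmanResidual G P q h z| ≤ 2 := fun k q hq =>
    abs_bellmanResidual_le hF hcomp hq.1 hq.2.1 h
  have hres : ∀ k, ∀ q ∈ constraintSet G F P br β (fun i h => Z i h ω) k,
      bellmanResidual G P q h ∈ residuals G F P h := fun k q hq =>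
    ⟨q.2, hq.2.1, q.1, hq.1, rfl⟩
  have hsplit : ∀ x y : ℝ, x - y ≤ |x| + |y| := fun x y => by
    linarith [le_abs_self x, neg_abs_le y]
  -- For Dirac measures the observed residuals are summed and `hgap` returns to expectations at cost
  -- `R`; for executed laws the expectations are summed directly.
  rcases min_le_iff.1 hd with hd | hd
  · have bound : ∀ q : Fin K → Policy S A H × QSeq S A H,
        (∀ k, q k ∈ constraintSet G F P br β (fun i h => Z i h ω) k) →
        ∑ k, |bellmanResidual G P (q k) h (Z k h ω)| ≤
          √(K * max 1 (d : ℝ)) * (3 + 2 * √B) := by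
      intro q hq
      have hdir : ∀ j k, ∫ z, bellmanResidual G P (q k) h z ∂(Measure.dirac (Z j h ω)) =
          bellmanResidual G P (q k) h (Z j h ω) := fun j k =>
        integral_dirac' _ _ (hmeas k _ (hq k)).stronglyMeasurable
      have := sum_abs_integral_le_of_dimDE_le hd hB (zero_le_two)
        (fun k => Measure.dirac (Z k h ω)) (fun k => bellmanResidual G P (q k) h)
        (fun k => ⟨_, rfl⟩) (fun k => hres k _ (hq k))
        (fun k => by rw [hdir]; exact habs k _ (hq k) _)
        (fun k => by simp_rw [hdir]; exact hsq k _ (hq k))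
      simp_rw [hdir] at this
      refine this.trans (le_of_eq ?_)
      ring
    have h1 := bound _ hmemf
    have h2 := bound _ hmemg
    have h3 : ∑ k, residualGap G br π f g k h ω (Z k h ω) ≤
        ∑ k, (|bellmanResidual G P (π k ω, f k ω) h (Z k h ω)| +
          |bellmanResidual G P (π k ω, g k ω) h (Z k h ω)|) :=
      Finset.sum_le_sum fun k _ => (hrun.residualGap_le hF hbr k h ω _).trans (hsplit _ _)
    rw [Finset.sum_add_distrib] at h3
    linarith
  · have bound : ∀ q : Fin K → Policy S A H × QSeq S A H,
        (∀ k, q k ∈ constraintSet G F P br β (fun i h => Z i h ω) k) →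
        ∑ k, |∫ z, bellmanResidual G P (q k) h z ∂(episodeLaw G br π g k h ω)| ≤
          √(K * max 1 (d : ℝ)) * (3 + 2 * √B) := by
      intro q hq
      have := sum_abs_integral_le_of_dimDE_le hd hB (zero_le_two)
        (fun k => episodeLaw G br π g k h ω) (fun k => bellmanResidual G P (q k) h)
        (fun k => ⟨_, (hmemf k).1, _, (hmemg k).2.1, rfl⟩) (fun k => hres k _ (hq k))
        (fun k => abs_integral_le_of_abs_le (habs k _ (hq k)))
        (fun k => hsqI k _ (hq k))
      refine this.trans (le_of_eq ?_)
      ring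
    have h1 := bound _ hmemf
    have h2 := bound _ hmemg
    have h3 : ∑ k, ∫ z, residualGap G br π f g k h ω z ∂(episodeLaw G br π g k h ω) ≤
        ∑ k, (|∫ z, bellmanResidual G P (π k ω, f k ω) h z ∂(episodeLaw G br π g k h ω)| +
          |∫ z, bellmanResidual G P (π k ω, g k ω) h z ∂(episodeLaw G br π g k h ω)|) := by
      refine Finset.sum_le_sum fun k _ => le_trans ?_ (hsplit _ _)
      have if' : Integrable (bellmanResidual G P (π k ω, f k ω) h) (episodeLaw G br π g k h ω) :=
        integrable_of_abs_le (hmeas k _ (hmemf k)) (habs k _ (hmemf k))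
      have ig' : Integrable (bellmanResidual G P (π k ω, g k ω) h) (episodeLaw G br π g k h ω) :=
        integrable_of_abs_le (hmeas k _ (hmemg k)) (habs k _ (hmemg k))
      rw [← integral_sub if' ig']
      refine integral_mono (integrable_of_abs_le ?_ (hrun.abs_residualGap_le hF k h ω))
        (if'.sub ig') fun z => hrun.residualGap_le hF hbr k h ω z
      exact (hrun.measurable_residualGap k h).comp
        (@measurable_prodMk_left _ _ (pastEpisodes Z k) _ ω)
    rw [Finset.sum_add_distrib] at h3
    linarith

end Regret

/-! ### The good event and the final bound -/

section Main

variable {S A : Type*} [MeasurableSpace S] [MeasurableSpace A]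
  {H K : ℕ}
  {G : Game S A H} {F : Fin H → Set (S × A × A → ℝ)} {P : Fin H → Set (StepPolicy S A)}
  {br : Fin H → (S × A × A → ℝ) → StepPolicy S A → StepPolicy S A} {β : ℝ}
  {Ω : Type*} [mΩ : MeasurableSpace Ω] {μ : Measure Ω}
  {Z : Fin K → Fin H → Ω → S × A × A} {π : Fin K → Ω → Policy S A H}
  {f g : Fin K → Ω → QSeq S A H}

lemma measure_biUnion_le_card_mul {ι : Type*} (T : Finset ι) (B : ι → Set Ω) {δ : ℝ}
    (h : ∀ i ∈ T, μ (B i) ≤ ENNReal.ofReal δ) :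
    μ (⋃ i ∈ T, B i) ≤ ENNReal.ofReal (T.card * δ) := by
  refine (measure_biUnion_finset_le T B).trans ((Finset.sum_le_sum h).trans ?_)
  rw [Finset.sum_const, nsmul_eq_mul, ENNReal.ofReal_mul (by positivity)]
  simp

lemma toNat_coveringNumber_pos {X : Type*} [PseudoEMetricSpace X] {s : Set X} {ε : ℝ≥0}
    (hs : s.Nonempty) (h : Metric.coveringNumber ε s ≠ ⊤) :
    1 ≤ (Metric.coveringNumber ε s).toNat := by
  have h1 := Metric.coveringNumber_pos_iff (ε := ε).2 hs
  rw [Nat.one_le_iff_ne_zero]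
  intro h0
  rcases (ENat.toNat_eq_zero).1 h0 with h2 | h2
  · exact h1.ne' h2
  · exact h h2

variable [Finite A] [MeasurableSingletonClass A]

/-- The concentration bounds for a net hold simultaneously with high probability. -/
lemma IsRun.exists_good_event [IsProbabilityMeasure μ] (hrun : IsRun G F P br β μ Z π f g)
    (hF : IsBoundedClass F) (hbr : IsBestResponseMap F P br) (hcomp : StrongCompleteness G F P)
    (s : Finset (Policy S A H × QSeq S A H))
    (hs : ∀ q ∈ s, q.1 ∈ prodClass P ∧ q.2 ∈ prodClass F) {δ : ℝ} (hδ : 0 < δ) (t : ℝ) :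
    ∃ bad : Set Ω, μ bad ≤ ENNReal.ofReal ((2 * (K * H * s.card) + H) * δ) ∧ ∀ ω ∉ bad,
      (∀ k h, ∀ q ∈ s, ∑ i with i < k, (-(1 / 4) * bellmanResidual G P q h (Z i h ω) *
        targetNoise G P q h (fun j => Z i j ω) - bellmanResidual G P q h (Z i h ω) ^ 2 / 32) ≤
          Real.log (1 / δ)) ∧
      (∀ k h, ∀ q ∈ s, ∑ i with i < k,
        ((∫ z, bellmanResidual G P q h z ^ 2 ∂(episodeLaw G br π g i h ω)) / 8 -
          bellmanResidual G P q h (Z i h ω) ^ 2 / 4) ≤ Real.log (1 / δ)) ∧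
      ∀ h, ∑ k, (t * (∫ z, residualGap G br π f g k h ω z ∂(episodeLaw G br π g k h ω) -
        residualGap G br π f g k h ω (Z k h ω)) - 18 * t ^ 2) ≤ Real.log (1 / δ) := by
  classical
  let T : Finset ((Fin K × Fin H) × (Policy S A H × QSeq S A H)) := Finset.univ ×ˢ s
  have hT : (T.card : ℝ) = K * H * s.card := by simp [T]
  -- The exceptional sets, left as `_`, are those of the deviation bounds. The gap bound `b3` is
  -- needed only once per step, which gives the separate `H` in the total.
  have b1 := measure_biUnion_le_card_mul (μ := μ) T (fun r => _) fun r hr =>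
    hrun.measure_noise_le hF hbr hcomp (hs r.2 (Finset.mem_product.1 hr).2).1
      (hs r.2 (Finset.mem_product.1 hr).2).2 r.1.1 r.1.2 hδ
  have b2 := measure_biUnion_le_card_mul (μ := μ) T (fun r => _) fun r hr =>
    hrun.measure_sq_le hF hcomp (hs r.2 (Finset.mem_product.1 hr).2).1
      (hs r.2 (Finset.mem_product.1 hr).2).2 r.1.1 r.1.2 hδ
  have b3 := measure_biUnion_le_card_mul (μ := μ) (Finset.univ : Finset (Fin H)) (fun h => _)
    fun h _ => hrun.measure_gap_le hF h hδ t
  refine ⟨_, (measure_union_le _ _).trans ((add_le_add ((measure_union_le _ _).trans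
    (add_le_add b1 b2)) b3).trans ?_), fun ω hω => ?_⟩
  · rw [← ENNReal.ofReal_add (by positivity) (by positivity),
      ← ENNReal.ofReal_add (by positivity) (by positivity)]
    refine ENNReal.ofReal_le_ofReal (le_of_eq ?_)
    rw [hT, Finset.card_univ, Fintype.card_fin]
    ring
  · simp only [Set.mem_union, Set.mem_iUnion, Set.mem_ofPred_eq, not_or, not_exists, not_lt] at hω
    obtain ⟨⟨h1, h2⟩, h3⟩ := hω
    exact ⟨fun k h q hq => h1 ((k, h), q) (Finset.mem_product.2 ⟨Finset.mem_univ _, hq⟩),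
      fun k h q hq => h2 ((k, h), q) (Finset.mem_product.2 ⟨Finset.mem_univ _, hq⟩),
      fun h => h3 h (Finset.mem_univ _)⟩

/-- The regret on the event that the concentration bounds hold. -/
lemma IsRun.regret_le [IsProbabilityMeasure μ] {c L : ℝ} (hc : 100 ≤ c)
    (hrun : IsRun G F P br (c * L) μ Z π f g)
    (hF : IsBoundedClass F) (hbr : IsBestResponseMap F P br) (hcomp : StrongCompleteness G F P)
    (hdim : dimME G F P br √(1 / K) ≠ ⊤) (hK : 0 < K) (hL : 1 / 2 ≤ L)
    (s : Finset (Policy S A H × QSeq S A H))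
    (hs : ∀ q ∈ s, q.1 ∈ prodClass P ∧ q.2 ∈ prodClass F)
    (hnet : ∀ q : Policy S A H × QSeq S A H, q.1 ∈ prodClass P → q.2 ∈ prodClass F →
      ∃ q' ∈ s, IsClose F (1 / K) q q') (ω : Ω)
    (h1 : ∀ k h, ∀ q ∈ s, ∑ i with i < k, (-(1 / 4) * bellmanResidual G P q h (Z i h ω) *
        targetNoise G P q h (fun j => Z i j ω) - bellmanResidual G P q h (Z i h ω) ^ 2 / 32) ≤
          3 * L)
    (h2 : ∀ k h, ∀ q ∈ s, ∑ i with i < k,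
        ((∫ z, bellmanResidual G P q h z ^ 2 ∂(episodeLaw G br π g i h ω)) / 8 -
          bellmanResidual G P q h (Z i h ω) ^ 2 / 4) ≤ 3 * L)
    (h3 : ∀ h, ∑ k, (√(L / K) *
        (∫ z, residualGap G br π f g k h ω z ∂(episodeLaw G br π g k h ω) -
        residualGap G br π f g k h ω (Z k h ω)) - 18 * √(L / K) ^ 2) ≤ 3 * L) :
    regret G P (fun k => π k ω) ≤ (33 + 4 * √(4 * c + 500)) *
      (H * √(K * max 1 ((dimME G F P br √(1 / K)).toNat : ℝ) * L)) := by
  have hK' : (0 : ℝ) < K := by exact_mod_cast hK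
  have hL0 : 0 < L := by linarith
  have hexc : ∀ k, ∀ q : Policy S A H × QSeq S A H, q.1 ∈ prodClass P → q.2 ∈ prodClass F →
      ∀ h, 1 / 2 * ∑ i with i < k, bellmanResidual G P q h (Z i h ω) ^ 2 - 100 * L ≤
      ∑ i with i < k, (bellmanResidual G P q h (Z i h ω) ^ 2 +
        2 * (bellmanResidual G P q h (Z i h ω) *
          targetNoise G P q h (fun j => Z i j ω))) := by
    intro k q hq1 hq2 h
    obtain ⟨q', hq', hqq⟩ := hnet q hq1 hq2
    exact half_sum_sq_le_excess hF hbr hcomp hq1 hq2 (hs q' hq').1 (hs q' hq').2 hqq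
      (fun i j => Z i j ω) k h hL (h1 k h q' hq')
  have hsq : ∀ h k, ∀ q ∈ constraintSet G F P br (c * L) (fun i h => Z i h ω) k,
      ∑ i with i < k, bellmanResidual G P q h (Z i h ω) ^ 2 ≤ 2 * (c * L) + 200 * L :=
    fun h k q hq => sum_sq_le_of_mem_constraintSet hbr hcomp (fun i j => Z i j ω) k (hexc k) hq h
  have hsqI : ∀ h k, ∀ q ∈ constraintSet G F P br (c * L) (fun i h => Z i h ω) k,
      ∑ i with i < k, (∫ z, bellmanResidual G P q h z ∂(episodeLaw G br π g i h ω)) ^ 2 ≤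
        (4 * c + 500) * L := by
    intro h k q hq
    obtain ⟨q', hq', hqq⟩ := hnet q hq.1 hq.2.1
    have := sum_sq_integral_le hF hbr hcomp hq.1 hq.2.1 (hs q' hq').1 (hs q' hq').2 hqq
      (fun i j => Z i j ω) (fun i => episodeLaw G br π g i h ω) (fun _ => inferInstance) k h hL
      (h2 k h q' hq')
    have h' := hsq h k q hq
    linarith
  have hcL : 0 ≤ c * L := by nlinarith
  -- The tilt √(L/K) balances 3 L against the compensator 18 t² K = 18 L; dividing the sum 21 L by
  -- it gives 21 √(K L).
  have hgap : ∀ h, ∑ k, ∫ z, residualGap G br π f g k h ω z ∂(episodeLaw G br π g k h ω) ≤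
      ∑ k, residualGap G br π f g k h ω (Z k h ω) + 21 * √(K * L) := by
    intro h
    have h4 := h3 h
    have ht : 0 < √(L / K) := Real.sqrt_pos.2 (by positivity)
    have ht2 : √(L / K) ^ 2 = L / K := Real.sq_sqrt (by positivity)
    have ht3 : √(L / K) * √(K * L) = L := by
      rw [← Real.sqrt_mul (by positivity)]
      have : L / K * (K * L) = L ^ 2 := by field_simp
      rw [this, Real.sqrt_sq hL0.le]
    rw [Finset.sum_sub_distrib, ← Finset.mul_sum, Finset.sum_sub_distrib, Finset.sum_const,
      Finset.card_univ, Fintype.card_fin, nsmul_eq_mul, ht2] at h4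
    have h5 : (K : ℝ) * (18 * (L / K)) = 18 * L := by field_simp
    rw [h5] at h4
    have h6 : √(L / K) * (∑ k, ∫ z, residualGap G br π f g k h ω z
        ∂(episodeLaw G br π g k h ω) - ∑ k, residualGap G br π f g k h ω (Z k h ω)) ≤
        √(L / K) * (21 * √(K * L)) := by
      linarith
    have := le_of_mul_le_mul_left h6 ht
    linarith
  set m : ℝ := max 1 ((dimME G F P br √(1 / K)).toNat : ℝ) with hm
  have hm1 : 1 ≤ m := le_max_left _ _
  have hstep : ∀ h, ∑ k, ∫ z, residualGap G br π f g k h ω z ∂(episodeLaw G br π g k h ω) ≤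
      (33 + 4 * √(4 * c + 500)) * √(K * m * L) := by
    intro h
    refine (hrun.sum_integral_gap_le hF hbr hcomp hdim h ω (B := (4 * c + 500) * L)
      (R := 21 * √(K * L)) (by nlinarith) (by positivity)
      (fun k q hq => (hsq h k q hq).trans (by nlinarith)) (hsqI h) (hgap h)).trans ?_
    have e1 : √(K * m * L) = √(K * m) * √L := Real.sqrt_mul (by positivity) _
    have e2 : √((4 * c + 500) * L) = √(4 * c + 500) * √L := Real.sqrt_mul (by linarith) _
    have e3 : √(K * L) ≤ √(K * m * L) := Real.sqrt_le_sqrt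
      (mul_le_mul_of_nonneg_right (le_mul_of_one_le_right hK'.le hm1) hL0.le)
    -- The term 6 √(K m) has no factor √L and becomes 12 √(K m L); together with 21 this makes 33.
    have e4 : 1 ≤ 2 * √L := by
      have : 1 / 2 ≤ √L := Real.le_sqrt_of_sq_le (by linarith)
      linarith
    have e5 : √(K * m) * 1 ≤ √(K * m) * (2 * √L) :=
      mul_le_mul_of_nonneg_left e4 (Real.sqrt_nonneg _)
    rw [e2]
    rw [e1] at e3 ⊢
    nlinarith
  have hreg : regret G P (fun k => π k ω) ≤
      ∑ k, ∑ h, ∫ z, residualGap G br π f g k h ω z ∂(episodeLaw G br π g k h ω) := by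
    refine Finset.sum_le_sum fun k _ =>
      hrun.gameValue_sub_worstValue_le hF hbr hcomp k ω fun π' hπ' Q hQ hfix => ?_
    exact fixedPoint_mem_constraintSet hbr (L := L) (by nlinarith) (fun i j => Z i j ω) k (hexc k)
      hπ' hQ hfix
  rw [Finset.sum_comm] at hreg
  refine hreg.trans ((Finset.sum_le_sum fun h _ => hstep h).trans (le_of_eq ?_))
  rw [Finset.sum_const, Finset.card_univ, Fintype.card_fin, nsmul_eq_mul]
  ring

end Main

end MarkovGame

theorem mainTheorem4 :
    ∃ c₀ : ℝ, 0 < c₀ ∧ ∀ c : ℝ, c₀ ≤ c → ∃ C : ℝ, 0 < C ∧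
      ∀ (S A : Type*) [MeasurableSpace S] [Finite A] [MeasurableSpace A]
        [MeasurableSingletonClass A] (H K : ℕ) (p : ℝ)
        (G : MarkovGame.Game S A H)
        (F : Fin H → Set (S × A × A → ℝ)) (P : Fin H → Set (MarkovGame.StepPolicy S A))
        (br : Fin H → (S × A × A → ℝ) → MarkovGame.StepPolicy S A → MarkovGame.StepPolicy S A)
        (Ω : Type*) [MeasurableSpace Ω] (μ : Measure Ω) [IsProbabilityMeasure μ]
        (Z : Fin K → Fin H → Ω → S × A × A) (π : Fin K → Ω → MarkovGame.Policy S A H)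
        (f g : Fin K → Ω → MarkovGame.QSeq S A H),
        2 ≤ H * K → 0 < p → p < 1 →
        MarkovGame.IsBoundedClass F →
        MarkovGame.IsBestResponseMap F P br →
        MarkovGame.StrongRealizability G F P →
        MarkovGame.StrongCompleteness G F P →
        MarkovGame.coverF F (1 / K) ≠ ⊤ →
        MarkovGame.coverP F P (1 / K) ≠ ⊤ →
        MarkovGame.dimME G F P br √(1 / K) ≠ ⊤ →
        MarkovGame.IsRun G F P br (c * MarkovGame.logTerm F P K p) μ Z π f g →
        μ {ω | ¬ MarkovGame.regret G P (fun k => π k ω) ≤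
            C * (H * √(K * max 1 ((MarkovGame.dimME G F P br √(1 / K)).toNat : ℝ) *
              MarkovGame.logTerm F P K p))} ≤ ENNReal.ofReal p := by
  -- The value 100 is the slack `100 * L ≤ β` that keeps the fixed points in the constraint sets.
  refine ⟨100, by norm_num, fun c hc => ⟨33 + 4 * √(4 * c + 500), by positivity, ?_⟩⟩
  intro S A _ _ _ _ H K p G F P br Ω _ μ _ Z π f g hHK hp hp1 hF hbr _ hcomp hFc hPc hdim hrun
  have hK : 0 < K := Nat.pos_of_ne_zero (by rintro rfl; simp at hHK)
  have hH : 0 < H := Nat.pos_of_ne_zero (by rintro rfl; simp at hHK)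
  -- Nonemptiness of the classes comes from the algorithm's choices at one sample point; it makes
  -- the covering numbers at least 1.
  obtain ⟨ω₀⟩ : Nonempty Ω := nonempty_of_isProbabilityMeasure μ
  obtain ⟨hπ₀, hf₀, -⟩ := hrun.mem_prodClass ⟨0, hK⟩ ω₀
  have hNF : 1 ≤ (MarkovGame.coverF F (1 / K)).toNat :=
    MarkovGame.toNat_coveringNumber_pos (Set.Nonempty.image _ ⟨_, hf₀⟩) hFc
  have hNP : 1 ≤ (MarkovGame.coverP F P (1 / K)).toNat :=
    MarkovGame.toNat_coveringNumber_pos (Set.Nonempty.image _ ⟨_, hπ₀⟩) hPc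
  obtain ⟨s, hs, hcard, hnet⟩ := MarkovGame.exists_net (1 / K) hFc hPc
  set NF := (MarkovGame.coverF F (1 / K)).toNat with hNFdef
  set NP := (MarkovGame.coverP F P (1 / K)).toNat with hNPdef
  set L := MarkovGame.logTerm F P K p with hLdef
  set N : ℝ := NF * NP * H * K with hN
  have hN2 : 2 ≤ N := by
    have h1 : 2 ≤ NF * NP * H * K := by
      calc 2 ≤ 1 * 1 * (H * K) := by simpa using hHK
        _ ≤ NF * NP * (H * K) := by gcongr
        _ = NF * NP * H * K := by ring
    rw [hN]
    exact_mod_cast h1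
  have hLeq : L = Real.log (N / p) := rfl
  have hlog2 : Real.log 2 ≤ L := by
    rw [hLeq]
    refine Real.log_le_log (by norm_num) ?_
    rw [le_div_iff₀ hp]
    nlinarith
  have hL : 1 / 2 ≤ L := by
    have := Real.log_two_gt_d9
    linarith
  -- The union bound uses at most 3 N events. Moreover log(1/δ) = 2 log 2 + L ≤ 3 L, since N/p ≥ 2.
  set δ := p / (4 * N) with hδdef
  have hδ : 0 < δ := by positivity
  have hlogδ : Real.log (1 / δ) ≤ 3 * L := by
    have h1 : 1 / δ = 2 ^ 2 * (N / p) := by rw [hδdef]; field_simp; norm_num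
    rw [h1, Real.log_mul (by norm_num) (by positivity), Real.log_pow, ← hLeq]
    push_cast
    linarith
  obtain ⟨bad, hbad, hgood⟩ := hrun.exists_good_event hF hbr hcomp s hs hδ √(L / K)
  -- The set where the regret is large need not be measurable; it is only compared with the
  -- exceptional set.
  refine (measure_mono fun ω hω => ?_).trans (hbad.trans (ENNReal.ofReal_le_ofReal ?_))
  · by_contra hnb
    obtain ⟨g1, g2, g3⟩ := hgood ω hnb
    refine hω (hrun.regret_le hc hF hbr hcomp hdim hK hL s hs ?_ ω
      (fun k h q hq => (g1 k h q hq).trans hlogδ) (fun k h q hq => (g2 k h q hq).trans hlogδ)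
      (fun h => (g3 h).trans hlogδ))
    simpa using hnet
  · have h1 : (K : ℝ) * H * s.card ≤ N := by
      have : (s.card : ℝ) ≤ NF * NP := by exact_mod_cast hcard
      calc (K : ℝ) * H * s.card ≤ K * H * (NF * NP) := by gcongr
        _ = N := by rw [hN]; ring
    have h2 : (H : ℝ) ≤ N := by
      have : H ≤ NF * NP * H * K := by
        calc H = 1 * 1 * H * 1 := by ring
          _ ≤ NF * NP * H * K := by gcongr; exact hK
      rw [hN]
      exact_mod_cast this
    calc (2 * (K * H * s.card) + H) * δ ≤ (4 * N) * δ :=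
          mul_le_mul_of_nonneg_right (by linarith) hδ.le
      _ = p := by rw [hδdef]; field_simp
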